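/- Let $N\ge 2$. In the star network, $N$ independent sources produce states $\rho_{A_iE_i}$ on $\mathcal H_{A_i}\otimes\mathcal H_{E_i}$, $i=1,\dots,N$, all spaces being finite-dimensional. The external party $A_i$ has three measurements $x_i\in\{0,1,2\}$ with two outcomes each, given by POVMs $\{M^{(i)}_{a|x}\}_{a=0,1}$ on $\mathcal H_{A_i}$, with observables $A_{i,x}=M^{(i)}_{0|x}-M^{(i)}_{1|x}$. The central party, Eve, performs one measurement with POVM $\{R_l\}$ on $\bigotimes_i\mathcal H_{E_i}$, whose $2^N$ outcomes are written as bit strings $l=l_1\dots l_N$. In real quantum theory (RQT) all states $\rho_{A_iE_i}$ and all effects $M^{(i)}_{a|x}$, $R_l$ are real matrices in a fixed product basis. For an operator $O$ of the external parties, let $\langle O\rangle_l=\mathrm{Tr}\big[(O\otimes R_l)\bigotimes_i\rho_{A_iE_i}\big]/\overline P(l)$, with $\overline P(l)=\mathrm{Tr}\big[(\mathbb 1\otimes R_l)\bigotimes_i\rho_{A_iE_i}\big]$, be its expectation conditioned on Eve's outcome $l$. Put $\tilde A_{1,0}=(A_{1,0}-A_{1,1})/\sqrt2$, $\tilde A_{1,1}=(A_{1,0}+A_{1,1})/\sqrt2$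 and $$\mathcal I_l=\Big\langle(-1)^{l_1}\Big[(N-1)\,\tilde A_{1,1}\bigotimes_{i=2}^N A_{i,1}+\sum_{i=2}^N(-1)^{l_i}\tilde A_{1,0}\otimes A_{i,0}\Big]\Big\rangle_l,$$ $$\mathcal J_N=-\frac{2}{N(N-1)}\Big[\sum_{2\le j_1<j_2\le N}\Big\langle\tilde A_{1,1}A_{j_1,2}A_{j_2,2}\prod_{\substack{i=2\\ i\ne j_1,j_2}}^N A_{i,1}\Big\rangle_{0\dots0}+\sum_{j=2}^N\Big\langle A_{1,2}A_{j,2}\prod_{\substack{i=2\\ i\ne j}}^N A_{i,1}\Big\rangle_{0\dots0}\Big].$$ **Theorem.** In RQT, assume that $\overline P(l)>0$ and that $\mathcal I_l$ is maximally violated, that is, $\mathcal I_l=2(N-1)$, for every outcome $l$ of Eve. Then $\mathcal J_N\le \frac1{N-1}$. If $N$ is even, this bound is attained: $\frac1{N-1}$ is the maximal value of $\mathcal J_N$ over all RQT realizations with $\mathcal I_l=2(N-1)$ for all $l$. -/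

import Mathlib

open scoped Kronecker

noncomputable section

/-- The tensor product `⨂ i, M i` of finitely many operators, in the product basis. -/
def tensorOp {N : ℕ} {d : Fin N → ℕ} (M : ∀ i, Matrix (Fin (d i)) (Fin (d i)) ℝ) :
    Matrix (∀ i, Fin (d i)) (∀ i, Fin (d i)) ℝ :=
  Matrix.of fun a b => ∏ i, M i (a i) (b i)

/-- A realization of the star network with `N` external parties in real quantum theory.
Source `i` distributes a real state on `ℝ ^ dA i ⊗ ℝ ^ dE i` to the external party `i` and to
the central party (Eve). Every external party has three two-outcome measurements, Eve has one
measurement, whose outcomes are the `2 ^ N` bit strings of length `N`. Everything is a real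
matrix in the fixed (product) basis; states may be mixed and measurements are POVMs.
The parties are numbered from `0`. -/
structure RealStarNetwork (N : ℕ) where
  /-- dimension of the space of external party `i` -/
  dA : Fin N → ℕ
  /-- dimension of the part of Eve's space that belongs to source `i` -/
  dE : Fin N → ℕ
  /-- the state generated by source `i` -/
  ρ : ∀ i, Matrix (Fin (dA i) × Fin (dE i)) (Fin (dA i) × Fin (dE i)) ℝ
  ρ_posSemidef : ∀ i, (ρ i).PosSemidef
  ρ_trace : ∀ i, (ρ i).trace = 1
  /-- `M i x a` is the effect of outcome `a` of measurement `x` of external party `i` -/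
  M : ∀ i, Fin 3 → Fin 2 → Matrix (Fin (dA i)) (Fin (dA i)) ℝ
  M_posSemidef : ∀ i x a, (M i x a).PosSemidef
  M_sum : ∀ i x, ∑ a, M i x a = 1
  /-- `R l` is the effect of Eve's outcome `l` -/
  R : (Fin N → Fin 2) → Matrix (∀ i, Fin (dE i)) (∀ i, Fin (dE i)) ℝ
  R_posSemidef : ∀ l, (R l).PosSemidef
  R_sum : ∑ l, R l = 1

namespace RealStarNetwork

variable {N : ℕ} (S : RealStarNetwork N)

/-- The operators on the joint space of all external parties. -/
abbrev OpA : Type := Matrix (∀ i, Fin (S.dA i)) (∀ i, Fin (S.dA i)) ℝ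

/-- The joint state `⨂ i, ρ i` of the external parties and Eve, with the external factors
collected on the left and Eve's factors on the right. -/
def jointState :
    Matrix ((∀ i, Fin (S.dA i)) × (∀ i, Fin (S.dE i)))
      ((∀ i, Fin (S.dA i)) × (∀ i, Fin (S.dE i))) ℝ :=
  Matrix.of fun p q => ∏ i, S.ρ i (p.1 i, p.2 i) (q.1 i, q.2 i)

/-- The probability of Eve's outcome `l`. -/
def probEve (l : Fin N → Fin 2) : ℝ :=
  (S.jointState * ((1 : S.OpA) ⊗ₖ S.R l)).trace

/-- The expectation value of an operator `O` of the external parties in their (normalized)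
state conditioned on Eve's outcome `l`. -/
def condExpect (l : Fin N → Fin 2) (O : S.OpA) : ℝ :=
  (S.jointState * (O ⊗ₖ S.R l)).trace / S.probEve l

/-- The observable of measurement `x` of external party `i`. -/
def A (i : Fin N) (x : Fin 3) : Matrix (Fin (S.dA i)) (Fin (S.dA i)) ℝ :=
  S.M i x 0 - S.M i x 1

/-- `(A_0 - A_1) / √2` for external party `i`. -/
def tildeA0 (i : Fin N) : Matrix (Fin (S.dA i)) (Fin (S.dA i)) ℝ :=
  (1 / √2 : ℝ) • (S.A i 0 - S.A i 1)

/-- `(A_0 + A_1) / √2` for external party `i`. -/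
def tildeA1 (i : Fin N) : Matrix (Fin (S.dA i)) (Fin (S.dA i)) ℝ :=
  (1 / √2 : ℝ) • (S.A i 0 + S.A i 1)

variable [NeZero N]

/-- The Bell operator attached to Eve's outcome `l`; the distinguished first party is `0`. -/
def bellOp (l : Fin N → Fin 2) : S.OpA :=
  ((-1 : ℝ) ^ (l 0 : ℕ)) •
    (((N : ℝ) - 1) • tensorOp (fun i => if i = 0 then S.tildeA1 i else S.A i 1)
      + ∑ i with i ≠ 0, ((-1 : ℝ) ^ (l i : ℕ)) •
          tensorOp (fun j => if j = 0 then S.tildeA0 j else if j = i then S.A j 0 else 1))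

/-- The value of the Bell functional attached to `l`, conditioned on Eve's outcome `l`. -/
def bellValue (l : Fin N → Fin 2) : ℝ :=
  S.condExpect l (S.bellOp l)

/-- For every outcome `l` of Eve, the Bell functional attached to `l` has its maximal quantum
value `2 (N - 1)`. In particular every outcome has non-zero probability if `N ≥ 2`. -/
def MaximalViolation : Prop :=
  ∀ l, S.bellValue l = 2 * ((N : ℝ) - 1)

/-- The Mermin-type functional, conditioned on Eve's outcome `0 … 0`. -/
def merminValue : ℝ :=
  -(2 / ((N : ℝ) * ((N : ℝ) - 1))) *
    (∑ p : Fin N × Fin N with p.1 ≠ 0 ∧ p.2 ≠ 0 ∧ p.1 < p.2,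
        S.condExpect 0 (tensorOp (fun i =>
          if i = 0 then S.tildeA1 i else if i = p.1 ∨ i = p.2 then S.A i 2 else S.A i 1))
      + ∑ j : Fin N with j ≠ 0,
        S.condExpect 0 (tensorOp (fun i => if i = 0 ∨ i = j then S.A i 2 else S.A i 1)))

end RealStarNetwork

end

noncomputable section

/-! ### Positive semidefinite real matrices -/

section PosSemidef

/-! Write `X i`, `Z i` for `opX i`, `opZ i`, `r i` for the reduced state of party `i`, and `σ l` for
the unnormalized state of the external parties given Eve's outcome `l`. Since the sources are
independent, the `σ l` sum to the product of the `r i` (`sum_condState`).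

Maximal violation makes the parties behave like qubits. Twice the gap in each Bell inequality is a
sum of squares plus deficits `1 - A²`. Summing over `l` puts the deficits on a product state, where
each has a sign, so every square and every deficit vanishes (`deficits`). Hence `A²` acts as the
identity on `r i` for the first two observables, and each `σ l` is stabilized up to sign by the
product of all `X i` and by `Z 0 ⊗ Z i` (`localOp_mul_condState`). It follows that on `r i` the
operators `X i`, `Z i` are anticommuting involutions, and they commute with `r i` (`anticomm`,
`opX_comm`, `opZ_comm`).

The sum of all stabilizer words kills every `σ l` except `σ 0`, so `σ 0` is proportional to that sum
applied to the product state (`exists_sum_word_mul_redState`). Reality now enters: a symmetric real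
`A` satisfies `tr (A X Z r) = 0` by transposition, so the third observables have no `Y` part
(`trace_symm_mul_opX_mul_opZ_eq_zero`). When there is a third party, only the pure `X` word survives
and the expectations factorize as `q j * q k` with `q i = tr (A i 2 * X i * r i)` and `q i ^ 2 ≤ 1`
(`condExpect_pairOp`, `trace_mul_opX_sq_le`). The Mermin value is then `(∑ q² - (∑ q)²) / (N (N -
1)) ≤ 1 / (N - 1)`. For `N = 2` the bound is the trivial one.

Equality needs `q i = ±1` with `∑ q = 0`. For even `N`, maximally entangled pairs and a GHZ
measurement with `q i = (-1) ^ i` achieve this (`ghzNetwork_merminValue`). -/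

theorem Matrix.PosSemidef.transpose_eq {n : Type*} {σ : Matrix n n ℝ} (hσ : σ.PosSemidef) :
    σ.transpose = σ := by
  have := hσ.isHermitian.eq
  rwa [Matrix.conjTranspose_eq_transpose_of_trivial] at this

variable {n : Type*} [Fintype n]

theorem Matrix.PosSemidef.exists_eq_transpose_mul {σ : Matrix n n ℝ} (hσ : σ.PosSemidef) :
    ∃ B : Matrix n n ℝ, σ = B.transpose * B := by
  classical
  open scoped MatrixOrder in
  obtain ⟨B, hB⟩ := CStarAlgebra.nonneg_iff_eq_star_mul_self.mp hσ.nonneg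
  exact ⟨B, by rw [hB, Matrix.star_eq_conjTranspose, Matrix.conjTranspose_eq_transpose_of_trivial]⟩

theorem Matrix.PosSemidef.trace_conj_nonneg {σ : Matrix n n ℝ} (hσ : σ.PosSemidef)
    (K : Matrix n n ℝ) : 0 ≤ (K * σ * K.transpose).trace := by
  have := (hσ.mul_mul_conjTranspose_same K).trace_nonneg
  rwa [Matrix.conjTranspose_eq_transpose_of_trivial] at this

/-- With `σ = Bᵀ B` the trace is the squared Frobenius norm of `K Bᵀ`. This turns equality of
expectations into operator identities on a state. -/
theorem Matrix.PosSemidef.mul_eq_zero_of_trace {σ : Matrix n n ℝ} (hσ : σ.PosSemidef)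
    {K : Matrix n n ℝ} (h : (K * σ * K.transpose).trace = 0) : K * σ = 0 := by
  obtain ⟨B, rfl⟩ := hσ.exists_eq_transpose_mul
  have h1 : K * B.transpose = 0 := by
    rw [← Matrix.trace_mul_conjTranspose_self_eq_zero_iff,
      Matrix.conjTranspose_eq_transpose_of_trivial, ← h, Matrix.transpose_mul,
      Matrix.transpose_transpose]
    simp only [Matrix.mul_assoc]
  rw [← Matrix.mul_assoc, h1, Matrix.zero_mul]

theorem Matrix.PosSemidef.trace_sq_nonneg {σ : Matrix n n ℝ} (hσ : σ.PosSemidef)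
    {K : Matrix n n ℝ} (hK : K.transpose = K) : 0 ≤ (K * K * σ).trace := by
  have := hσ.trace_conj_nonneg K
  rwa [hK, Matrix.trace_mul_cycle] at this

/-- For a symmetric operator the trace of its square against a state vanishes only if it
annihilates the state. -/
theorem Matrix.PosSemidef.mul_eq_zero_of_trace_sq {σ : Matrix n n ℝ} (hσ : σ.PosSemidef)
    {K : Matrix n n ℝ} (hK : K.transpose = K) (h : (K * K * σ).trace = 0) : K * σ = 0 := by
  refine hσ.mul_eq_zero_of_trace ?_
  rw [hK, Matrix.trace_mul_cycle, h]

theorem Matrix.PosSemidef.trace_mul_nonneg {P Q : Matrix n n ℝ} (hP : P.PosSemidef)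
    (hQ : Q.PosSemidef) : 0 ≤ (P * Q).trace := by
  obtain ⟨B, rfl⟩ := hP.exists_eq_transpose_mul
  have := hQ.trace_conj_nonneg B
  rwa [Matrix.trace_mul_cycle] at this

/-- A positive semidefinite operator with vanishing expectation annihilates the state. -/
theorem Matrix.PosSemidef.mul_eq_zero_of_trace_mul {P Q : Matrix n n ℝ} (hP : P.PosSemidef)
    (hQ : Q.PosSemidef) (h : (P * Q).trace = 0) : P * Q = 0 := by
  obtain ⟨B, rfl⟩ := hP.exists_eq_transpose_mul
  rw [Matrix.mul_assoc, hQ.mul_eq_zero_of_trace (K := B), Matrix.mul_zero]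
  rwa [Matrix.trace_mul_cycle]

/-- Schur product theorem, iterated. Tensor products in the product basis are entrywise products of
pulled-back factors, so this gives their positivity. -/
theorem Matrix.posSemidef_of_prod {ι : Type*} (s : Finset ι) (f : ι → Matrix n n ℝ)
    (hf : ∀ i, (f i).PosSemidef) :
    (Matrix.of fun a b => ∏ i ∈ s, f i a b : Matrix n n ℝ).PosSemidef := by
  classical
  induction s using Finset.induction_on with
  | empty =>
    have : (Matrix.of fun a b => ∏ i ∈ (∅ : Finset ι), f i a b : Matrix n n ℝ)
        = Matrix.vecMulVec (fun _ => (1 : ℝ)) (star fun _ => 1) := by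
      ext a b; simp [Matrix.vecMulVec_apply]
    rw [this]
    exact Matrix.posSemidef_vecMulVec_self_star _
  | insert i s hi ih =>
    have : (Matrix.of fun a b => ∏ i ∈ insert i s, f i a b : Matrix n n ℝ)
        = Matrix.hadamard (f i) (Matrix.of fun a b => ∏ i ∈ s, f i a b) := by
      ext a b; simp [Finset.prod_insert hi, Matrix.hadamard_apply]
    rw [this]
    exact (hf i).hadamard ih

end PosSemidef

/-! ### Tensor products of operators -/

section Tensor

variable {N : ℕ} {d : Fin N → ℕ}

theorem tensorOp_apply (M : ∀ i, Matrix (Fin (d i)) (Fin (d i)) ℝ) (a b : ∀ i, Fin (d i)) :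
    tensorOp M a b = ∏ i, M i (a i) (b i) := rfl

theorem tensorOp_mul (M M' : ∀ i, Matrix (Fin (d i)) (Fin (d i)) ℝ) :
    tensorOp M * tensorOp M' = tensorOp (fun i => M i * M' i) := by
  ext a b
  simp only [Matrix.mul_apply, tensorOp_apply, ← Finset.prod_mul_distrib]
  exact (Fintype.prod_sum fun i j => M i (a i) j * M' i j (b i)).symm

theorem tensorOp_one : tensorOp (fun i => (1 : Matrix (Fin (d i)) (Fin (d i)) ℝ)) = 1 := by
  ext a b
  rw [tensorOp_apply]
  by_cases h : a = b
  · subst h; simp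
  · obtain ⟨i, hi⟩ := Function.ne_iff.mp h
    rw [Matrix.one_apply_ne h]
    exact Finset.prod_eq_zero (Finset.mem_univ i) (Matrix.one_apply_ne hi)

theorem tensorOp_trace (M : ∀ i, Matrix (Fin (d i)) (Fin (d i)) ℝ) :
    (tensorOp M).trace = ∏ i, (M i).trace := by
  simp only [Matrix.trace, Matrix.diag_apply, tensorOp_apply]
  exact (Fintype.prod_sum fun i j => M i j j).symm

theorem tensorOp_transpose (M : ∀ i, Matrix (Fin (d i)) (Fin (d i)) ℝ) :
    (tensorOp M).transpose = tensorOp (fun i => (M i).transpose) := rfl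

theorem tensorOp_posSemidef {M : ∀ i, Matrix (Fin (d i)) (Fin (d i)) ℝ}
    (hM : ∀ i, (M i).PosSemidef) : (tensorOp M).PosSemidef :=
  Matrix.posSemidef_of_prod Finset.univ 
    (fun i => (M i).submatrix (fun a : ∀ i, Fin (d i) => a i) fun a => a i)
    fun i => (hM i).submatrix _

theorem tensorOp_update_add (M : ∀ i, Matrix (Fin (d i)) (Fin (d i)) ℝ) (i : Fin N)
    (K L : Matrix (Fin (d i)) (Fin (d i)) ℝ) :
    tensorOp (Function.update M i (K + L))
      = tensorOp (Function.update M i K) + tensorOp (Function.update M i L) := by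
  ext a b
  simp only [Matrix.add_apply, tensorOp_apply]
  rw [← Finset.mul_prod_erase _ _ (Finset.mem_univ i), ← Finset.mul_prod_erase _ _ (Finset.mem_univ i),
    ← Finset.mul_prod_erase _ _ (Finset.mem_univ i)]
  simp only [Function.update_self, Matrix.add_apply, add_mul]
  congr 2 <;>
  · refine Finset.prod_congr rfl fun j hj => ?_
    simp [Function.update_of_ne (Finset.ne_of_mem_erase hj)]

/-- The operator `K` of party `i`, extended by the identity. -/
def localOp (i : Fin N) (K : Matrix (Fin (d i)) (Fin (d i)) ℝ) :
    Matrix (∀ i, Fin (d i)) (∀ i, Fin (d i)) ℝ :=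
  tensorOp (Function.update (fun _ => 1) i K)

theorem localOp_add (i : Fin N) (K L : Matrix (Fin (d i)) (Fin (d i)) ℝ) :
    localOp i (K + L) = localOp i K + localOp i L :=
  tensorOp_update_add _ i K L

theorem localOp_mul (i : Fin N) (K L : Matrix (Fin (d i)) (Fin (d i)) ℝ) :
    localOp i (K * L) = localOp i K * localOp i L := by
  rw [localOp, localOp, localOp, tensorOp_mul]
  congr 1
  ext1 j
  by_cases h : j = i
  · subst h; simp
  · simp [h]

theorem localOp_transpose (i : Fin N) (K : Matrix (Fin (d i)) (Fin (d i)) ℝ) :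
    (localOp i K).transpose = localOp i K.transpose := by
  rw [localOp, localOp, tensorOp_transpose]
  congr 1
  ext1 j
  by_cases h : j = i
  · subst h; simp
  · simp [h]

theorem localOp_mul_localOp {i j : Fin N} (hij : i ≠ j) (K : Matrix (Fin (d i)) (Fin (d i)) ℝ)
    (L : Matrix (Fin (d j)) (Fin (d j)) ℝ) : localOp i K * localOp j L
      = tensorOp (Function.update (Function.update (fun _ => 1) i K) j L) := by
  rw [localOp, localOp, tensorOp_mul]
  congr 1
  ext1 k
  by_cases h : k = j
  · subst h; simp [hij.symm]
  · simp [h]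

theorem tensorOp_mul_localOp_comm (M : ∀ i, Matrix (Fin (d i)) (Fin (d i)) ℝ) (i : Fin N)
    (hM : M i = 1) (K : Matrix (Fin (d i)) (Fin (d i)) ℝ) :
    tensorOp M * localOp i K = localOp i K * tensorOp M := by
  rw [localOp, tensorOp_mul, tensorOp_mul]
  congr 1
  ext1 k
  by_cases h : k = i
  · subst h; simp [hM]
  · simp [h]

theorem localOp_comm {i j : Fin N} (hij : i ≠ j) (K : Matrix (Fin (d i)) (Fin (d i)) ℝ)
    (L : Matrix (Fin (d j)) (Fin (d j)) ℝ) :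
    localOp i K * localOp j L = localOp j L * localOp i K :=
  tensorOp_mul_localOp_comm _ j (by simp [hij.symm]) L

theorem localOp_trace_mul (i : Fin N) (K : Matrix (Fin (d i)) (Fin (d i)) ℝ)
    (M : ∀ i, Matrix (Fin (d i)) (Fin (d i)) ℝ) (hM : ∀ j, j ≠ i → (M j).trace = 1) :
    (localOp i K * tensorOp M).trace = (K * M i).trace := by
  rw [localOp, tensorOp_mul, tensorOp_trace, Finset.prod_eq_single i]
  · simp
  · intro j _ hj; simp [hj, hM j hj]
  · simp

/-- Partial traces: a tensor product can be compared factor by factor. -/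
theorem eq_of_tensorOp_eq {M M' : ∀ i, Matrix (Fin (d i)) (Fin (d i)) ℝ} (i : Fin N)
    (h : tensorOp M = tensorOp M') (hM : ∀ j, j ≠ i → (M j).trace = 1)
    (hM' : ∀ j, j ≠ i → (M' j).trace = 1) : M i = M' i := by
  refine Matrix.ext_iff_trace_mul_left.mpr fun K => ?_
  rw [← localOp_trace_mul i K M hM, h, localOp_trace_mul i K M' hM']

theorem add_eq_zero_of_tensorOp_add_eq_zero {M M' : ∀ i, Matrix (Fin (d i)) (Fin (d i)) ℝ}
    (i : Fin N) (h : tensorOp M + tensorOp M' = 0) (hM : ∀ j, j ≠ i → (M j).trace = 1)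
    (hM' : ∀ j, j ≠ i → (M' j).trace = 1) : M i + M' i = 0 := by
  refine Matrix.ext_iff_trace_mul_left.mpr fun K => ?_
  rw [Matrix.mul_add, Matrix.trace_add, ← localOp_trace_mul i K M hM,
    ← localOp_trace_mul i K M' hM', ← Matrix.trace_add, ← Matrix.mul_add, h]
  simp

end Tensor

/-! ### Reduced and conditional states of the external parties -/

namespace RealStarNetwork

variable {N : ℕ} (S : RealStarNetwork N)

/-- The reduced state of external party `i`. -/
def redState (i : Fin N) : Matrix (Fin (S.dA i)) (Fin (S.dA i)) ℝ :=
  ∑ e, (S.ρ i).submatrix (fun a => (a, e)) fun a => (a, e)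

theorem redState_posSemidef (i : Fin N) : (S.redState i).PosSemidef :=
  Matrix.posSemidef_sum _ fun _ _ => (S.ρ_posSemidef i).submatrix _

theorem redState_transpose (i : Fin N) : (S.redState i).transpose = S.redState i :=
  (S.redState_posSemidef i).transpose_eq

theorem redState_trace (i : Fin N) : (S.redState i).trace = 1 := by
  rw [← S.ρ_trace i]
  simp only [redState, Matrix.trace, Matrix.diag_apply, Matrix.sum_apply, Matrix.submatrix_apply,
    Fintype.sum_prod_type]

theorem jointState_posSemidef : S.jointState.PosSemidef :=
  Matrix.posSemidef_of_prod Finset.univ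
    (fun i => (S.ρ i).submatrix
      (fun p : (∀ i, Fin (S.dA i)) × (∀ i, Fin (S.dE i)) => (p.1 i, p.2 i))
      fun p => (p.1 i, p.2 i))
    fun i => (S.ρ_posSemidef i).submatrix _

/-- The unnormalized state of the external parties conditioned on Eve's outcome `l`. -/
def condState (l : Fin N → Fin 2) : S.OpA :=
  Matrix.of fun a a' => ∑ e, ∑ e', S.jointState (a, e) (a', e') * S.R l e' e

theorem trace_jointState_mul (l : Fin N → Fin 2) (O : S.OpA) :
    (S.jointState * (O ⊗ₖ S.R l)).trace = (O * S.condState l).trace := by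
  simp only [Matrix.trace, Matrix.diag_apply, Matrix.mul_apply, Matrix.kroneckerMap_apply,
    Fintype.sum_prod_type, condState, Matrix.of_apply, Finset.mul_sum]
  calc _ = ∑ a, ∑ a', ∑ e, ∑ e', S.jointState (a, e) (a', e') * (O a' a * S.R l e' e) :=
        Finset.sum_congr rfl fun a _ => Finset.sum_comm
    _ = _ := by
      rw [Finset.sum_comm]
      refine Finset.sum_congr rfl fun a _ => Finset.sum_congr rfl fun a' _ =>
        Finset.sum_congr rfl fun e _ => Finset.sum_congr rfl fun e' _ => by ring

/-- The quadratic form at `x` is the trace of the joint state against the positive operator `x xᵀ ⊗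
R l`. -/
theorem condState_posSemidef (l : Fin N → Fin 2) : (S.condState l).PosSemidef := by
  refine Matrix.PosSemidef.of_dotProduct_mulVec_nonneg ?_ fun x => ?_
  · ext a a'
    simp only [Matrix.conjTranspose_apply, condState, Matrix.of_apply, star_trivial]
    rw [Finset.sum_comm]
    refine Finset.sum_congr rfl fun e _ => Finset.sum_congr rfl fun e' _ => ?_
    have h1 := congrFun₂ S.jointState_posSemidef.transpose_eq (a, e) (a', e')
    have h2 := congrFun₂ (S.R_posSemidef l).transpose_eq e' e
    rw [Matrix.transpose_apply] at h1 h2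
    rw [h1, h2]
  · have h : star x ⬝ᵥ (S.condState l).mulVec x
        = (Matrix.vecMulVec x (star x) * S.condState l).trace := by
      rw [Matrix.vecMulVec_mul, Matrix.trace_vecMulVec, Matrix.dotProduct_mulVec,
        dotProduct_comm]
    rw [h, ← S.trace_jointState_mul]
    exact S.jointState_posSemidef.trace_mul_nonneg
      ((Matrix.posSemidef_vecMulVec_self_star x).kronecker (S.R_posSemidef l))

/-- Eve's effects sum to the identity, so forgetting her outcome leaves a partial trace, which
independent sources turn into a product. -/
theorem sum_condState : ∑ l, S.condState l = tensorOp S.redState := by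
  ext a a'
  have hR : ∀ e e', ∑ l, S.R l e' e = if e' = e then 1 else 0 := fun e e' => by
    rw [← Matrix.sum_apply, S.R_sum, Matrix.one_apply]
  simp only [Matrix.sum_apply, condState, Matrix.of_apply, tensorOp_apply, redState,
    Matrix.submatrix_apply, Fintype.prod_sum]
  rw [Finset.sum_comm]
  refine Finset.sum_congr rfl fun e _ => ?_
  rw [Finset.sum_comm]
  simp only [← Finset.mul_sum, hR, mul_ite, mul_one, mul_zero, Finset.sum_ite_eq',
    Finset.mem_univ, if_true]
  rfl

theorem probEve_eq (l : Fin N → Fin 2) : S.probEve l = (S.condState l).trace := by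
  rw [probEve, trace_jointState_mul, Matrix.one_mul]

theorem condExpect_eq (l : Fin N → Fin 2) (O : S.OpA) :
    S.condExpect l O = (O * S.condState l).trace / (S.condState l).trace := by
  rw [condExpect, trace_jointState_mul, probEve_eq]

theorem sum_trace_condState : ∑ l, (S.condState l).trace = 1 := by
  rw [← Matrix.trace_sum, sum_condState, tensorOp_trace]
  simp [redState_trace]

/-! ### Dichotomic observables -/

theorem A_transpose (i : Fin N) (x : Fin 3) : (S.A i x).transpose = S.A i x := by
  rw [A, Matrix.transpose_sub, (S.M_posSemidef i x 0).transpose_eq,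
    (S.M_posSemidef i x 1).transpose_eq]

/-- With effects `P + Q = 1`, which commute, `1 - (P - Q)² = 4 P Q = 4 (P Q P + Q P Q)`, and the
last form is manifestly positive. -/
theorem one_sub_A_sq_posSemidef (i : Fin N) (x : Fin 3) :
    (1 - S.A i x * S.A i x).PosSemidef := by
  have hsum : S.M i x 0 + S.M i x 1 = 1 := by simpa using S.M_sum i x
  have h1 : S.M i x 1 = 1 - S.M i x 0 := by rw [← hsum]; abel
  have h0 := S.M_posSemidef i x 0
  have h0' := S.M_posSemidef i x 1
  set P := S.M i x 0
  have key : 1 - S.A i x * S.A i x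
      = (4 : ℝ) • (P.conjTranspose * S.M i x 1 * P
        + (S.M i x 1).conjTranspose * P * S.M i x 1) := by
    rw [h0.isHermitian.eq, h0'.isHermitian.eq, A, h1]
    have : (4 : ℝ) • (P * (1 - P) * P + (1 - P) * P * (1 - P))
      = P * (1 - P) * P + (1 - P) * P * (1 - P) + (P * (1 - P) * P + (1 - P) * P * (1 - P))
       + (P * (1 - P) * P + (1 - P) * P * (1 - P)) + (P * (1 - P) * P + (1 - P) * P * (1 - P)) := by
      module
    rw [this]
    change 1 - (P - (1 - P)) * (P - (1 - P)) = _
    noncomm_ring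
  rw [key]
  exact ((h0'.conjTranspose_mul_mul_same P).add
    (h0.conjTranspose_mul_mul_same _)).smul (by norm_num)

theorem trace_A_sq_le (i : Fin N) (x : Fin 3) :
    (S.A i x * S.A i x * S.redState i).trace ≤ 1 := by
  have := (S.one_sub_A_sq_posSemidef i x).trace_mul_nonneg (S.redState_posSemidef i)
  rw [Matrix.sub_mul, Matrix.trace_sub, Matrix.one_mul, redState_trace] at this
  linarith

theorem trace_A_sq_nonneg (i : Fin N) (x : Fin 3) :
    0 ≤ (S.A i x * S.A i x * S.redState i).trace :=
  (S.redState_posSemidef i).trace_sq_nonneg (S.A_transpose i x)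

theorem A_sq_mul_redState (i : Fin N) (x : Fin 3)
    (h : (S.A i x * S.A i x * S.redState i).trace = 1) :
    S.A i x * S.A i x * S.redState i = S.redState i := by
  have := (S.one_sub_A_sq_posSemidef i x).mul_eq_zero_of_trace_mul (S.redState_posSemidef i) (by
    rw [Matrix.sub_mul, Matrix.trace_sub, Matrix.one_mul, redState_trace, h, sub_self])
  rw [Matrix.sub_mul, Matrix.one_mul, sub_eq_zero] at this
  exact this.symm

end RealStarNetwork

/-! ### Sum-of-squares decomposition of the Bell operators -/

theorem trace_sub_smul_sq_mul {n : Type*} [Fintype n] {P Q σ : Matrix n n ℝ} (h : P * Q = Q * P)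
    {s : ℝ} (hs : s * s = 1) :
    ((P - s • Q) * (P - s • Q) * σ).trace
      = (P * P * σ).trace + (Q * Q * σ).trace - 2 * s * (P * Q * σ).trace := by
  have : (P - s • Q) * (P - s • Q) = P * P + (s * s) • (Q * Q) - (2 * s) • (P * Q) := by
    rw [sub_mul, mul_sub, mul_sub, smul_mul_smul_comm, mul_smul_comm, smul_mul_assoc, ← h]
    module
  rw [this, hs, one_smul, Matrix.sub_mul, Matrix.add_mul, Matrix.trace_sub, Matrix.trace_add,
    Matrix.smul_mul, Matrix.trace_smul, smul_eq_mul]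

theorem sub_smul_transpose {n : Type*} {P Q : Matrix n n ℝ} (hP : P.transpose = P)
    (hQ : Q.transpose = Q) (s : ℝ) : (P - s • Q).transpose = P - s • Q := by
  rw [Matrix.transpose_sub, Matrix.transpose_smul, hP, hQ]

theorem sum_ne_zero_one (N : ℕ) [NeZero N] : ∑ i : Fin N with i ≠ 0, (1 : ℝ) = N - 1 := by
  have h := Finset.card_erase_of_mem (Finset.mem_univ (0 : Fin N))
  have : (Finset.univ.filter fun i : Fin N => i ≠ 0) = Finset.univ.erase 0 := by ext; simp
  rw [this, Finset.sum_const, h, Finset.card_univ, Fintype.card_fin, nsmul_eq_mul, mul_one,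
    Nat.cast_sub (NeZero.one_le), Nat.cast_one]

namespace RealStarNetwork

variable {N : ℕ} [NeZero N] (S : RealStarNetwork N)

/-- The operator of party `i` that acts as a Pauli `X` on the reduced state. -/
def opX (i : Fin N) : Matrix (Fin (S.dA i)) (Fin (S.dA i)) ℝ :=
  if i = 0 then S.tildeA1 i else S.A i 1

/-- The operator of party `i` that acts as a Pauli `Z` on the reduced state. -/
def opZ (i : Fin N) : Matrix (Fin (S.dA i)) (Fin (S.dA i)) ℝ :=
  if i = 0 then S.tildeA0 i else S.A i 0

/-- The product of the operators `S.opX i` of all parties except the distinguished one. -/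
def restX : S.OpA := tensorOp (fun i => if i = 0 then 1 else S.opX i)

theorem opX_zero : S.opX 0 = S.tildeA1 0 := if_pos rfl
theorem opZ_zero : S.opZ 0 = S.tildeA0 0 := if_pos rfl
theorem opX_of_ne {i : Fin N} (hi : i ≠ 0) : S.opX i = S.A i 1 := if_neg hi
theorem opZ_of_ne {i : Fin N} (hi : i ≠ 0) : S.opZ i = S.A i 0 := if_neg hi

theorem opX_transpose (i : Fin N) : (S.opX i).transpose = S.opX i := by
  unfold opX
  split_ifs
  · rw [tildeA1, Matrix.transpose_smul, Matrix.transpose_add, A_transpose, A_transpose]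
  · exact S.A_transpose i 1

theorem opZ_transpose (i : Fin N) : (S.opZ i).transpose = S.opZ i := by
  unfold opZ
  split_ifs
  · rw [tildeA0, Matrix.transpose_smul, Matrix.transpose_sub, A_transpose, A_transpose]
  · exact S.A_transpose i 0

theorem one_div_sqrt_two_mul_self : (1 / √2 : ℝ) * (1 / √2) = 1 / 2 := by
  rw [div_mul_div_comm, Real.mul_self_sqrt (by norm_num), one_mul]

theorem opX_sq_add_opZ_sq_zero :
    S.opX 0 * S.opX 0 + S.opZ 0 * S.opZ 0 = S.A 0 0 * S.A 0 0 + S.A 0 1 * S.A 0 1 := by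
  rw [opX_zero, opZ_zero, tildeA0, tildeA1, smul_mul_smul_comm, smul_mul_smul_comm,
    one_div_sqrt_two_mul_self]
  simp only [add_mul, mul_add, sub_mul, mul_sub]
  module

/-- Sum and difference of two observables anticommute exactly when their squares agree; this is
where anticommutation originates. -/
theorem opX_mul_opZ_add_zero :
    S.opX 0 * S.opZ 0 + S.opZ 0 * S.opX 0 = S.A 0 0 * S.A 0 0 - S.A 0 1 * S.A 0 1 := by
  rw [opX_zero, opZ_zero, tildeA0, tildeA1, smul_mul_smul_comm, smul_mul_smul_comm,
    one_div_sqrt_two_mul_self]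
  simp only [add_mul, mul_add, sub_mul, mul_sub]
  module

theorem restX_transpose : S.restX.transpose = S.restX := by
  rw [restX, tensorOp_transpose]
  congr 1
  ext1 i
  split_ifs
  · simp
  · exact S.opX_transpose i

theorem localOp_mul_restX : localOp 0 (S.opX 0) * S.restX = tensorOp S.opX := by
  rw [localOp, restX, tensorOp_mul]
  congr 1
  ext1 i
  by_cases h : i = 0
  · subst h; simp
  · simp [h]

theorem localOp_comm_restX (K : Matrix (Fin (S.dA 0)) (Fin (S.dA 0)) ℝ) :
    localOp 0 K * S.restX = S.restX * localOp 0 K :=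
  (tensorOp_mul_localOp_comm _ 0 (if_pos rfl) K).symm

/-- The sign attached to a bit of Eve's outcome. -/
def bitSign (l : Fin N → Fin 2) (i : Fin N) : ℝ := (-1 : ℝ) ^ (l i : ℕ)

omit [NeZero N] in
theorem bitSign_mul_self (l : Fin N → Fin 2) (i : Fin N) : bitSign l i * bitSign l i = 1 := by
  rw [bitSign, ← pow_add, ← two_mul, pow_mul]; simp

theorem bellOp_eq (l : Fin N → Fin 2) :
    S.bellOp l = bitSign l 0 • (((N : ℝ) - 1) • (localOp 0 (S.opX 0) * S.restX)
      + ∑ i with i ≠ 0, bitSign l i • (localOp 0 (S.opZ 0) * localOp i (S.opZ i))) := by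
  rw [localOp_mul_restX]
  unfold bellOp
  refine congrArg₂ (· • ·) rfl (congrArg₂ (· + ·) rfl (Finset.sum_congr rfl fun i hi => ?_))
  have hi : i ≠ 0 := (Finset.mem_filter.mp hi).2
  rw [localOp_mul_localOp hi.symm]
  congr 2
  ext1 j
  by_cases hj : j = i
  · subst hj; simp [hi, opZ]
  · by_cases hj0 : j = 0
    · subst hj0; simp [hj, opZ]
    · simp [hj, hj0]

theorem trace_bellOp_mul (l : Fin N → Fin 2) (σ : S.OpA) :
    (S.bellOp l * σ).trace
      = ((N : ℝ) - 1) * (bitSign l 0 * (localOp 0 (S.opX 0) * S.restX * σ).trace)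
        + ∑ i with i ≠ 0, (bitSign l 0 * bitSign l i)
            * (localOp 0 (S.opZ 0) * localOp i (S.opZ i) * σ).trace := by
  rw [bellOp_eq, Matrix.smul_mul, Matrix.trace_smul, Matrix.add_mul, Matrix.trace_add,
    Matrix.smul_mul, Matrix.trace_smul, Matrix.sum_mul, Matrix.trace_sum]
  simp only [Matrix.smul_mul, Matrix.trace_smul, smul_eq_mul, mul_add, Finset.mul_sum]
  congr 1
  · ring
  · exact Finset.sum_congr rfl fun i _ => by ring

variable {S}

theorem MaximalViolation.trace_ne_zero (hN : 2 ≤ N) (hS : S.MaximalViolation)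
    (l : Fin N → Fin 2) : (S.condState l).trace ≠ 0 := by
  intro h
  have h1 := hS l
  -- A conditional expectation on an outcome of probability zero is `0` by the division convention,
  -- which differs from `2 (N - 1) > 0`.
  rw [bellValue, condExpect_eq, h, div_zero] at h1
  have : (2 : ℝ) ≤ N := by exact_mod_cast hN
  linarith

theorem MaximalViolation.trace_bellOp (hN : 2 ≤ N) (hS : S.MaximalViolation)
    (l : Fin N → Fin 2) :
    (S.bellOp l * S.condState l).trace = 2 * ((N : ℝ) - 1) * (S.condState l).trace := by
  have h1 := hS l
  rwa [bellValue, condExpect_eq, div_eq_iff (hS.trace_ne_zero hN l)] at h1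

variable (S)

omit [NeZero N] in
theorem trace_localOp_mul_redState (i : Fin N) (K : Matrix (Fin (S.dA i)) (Fin (S.dA i)) ℝ) :
    (localOp i K * tensorOp S.redState).trace = (K * S.redState i).trace :=
  localOp_trace_mul i K _ fun j _ => S.redState_trace j

/-- The sum-of-squares defect of the Bell operator in the state conditioned on `l`. -/
def sosDefect (l : Fin N → Fin 2) : ℝ :=
  ((N : ℝ) - 1) * ((localOp 0 (S.opX 0) - bitSign l 0 • S.restX)
      * (localOp 0 (S.opX 0) - bitSign l 0 • S.restX) * S.condState l).trace
    + ∑ i with i ≠ 0,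
      ((localOp 0 (S.opZ 0) - (bitSign l 0 * bitSign l i) • localOp i (S.opZ i))
        * (localOp 0 (S.opZ 0) - (bitSign l 0 * bitSign l i) • localOp i (S.opZ i))
        * S.condState l).trace

/-- The cross terms of the squares carry exactly the signs and weights of the Bell operator. -/
theorem sosDefect_eq (l : Fin N → Fin 2) :
    S.sosDefect l
      = ((N : ℝ) - 1) * ((localOp 0 (S.opX 0) * localOp 0 (S.opX 0) * S.condState l).trace
          + (S.restX * S.restX * S.condState l).trace)
        + ∑ i with i ≠ 0, ((localOp 0 (S.opZ 0) * localOp 0 (S.opZ 0) * S.condState l).trace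
          + (localOp i (S.opZ i) * localOp i (S.opZ i) * S.condState l).trace)
        - 2 * (S.bellOp l * S.condState l).trace := by
  have hs : ∀ i, (bitSign l 0 * bitSign l i) * (bitSign l 0 * bitSign l i) = 1 := fun i => by
    rw [mul_mul_mul_comm, bitSign_mul_self, bitSign_mul_self, one_mul]
  have hsum : ∑ i with i ≠ 0,
      ((localOp 0 (S.opZ 0) - (bitSign l 0 * bitSign l i) • localOp i (S.opZ i))
        * (localOp 0 (S.opZ 0) - (bitSign l 0 * bitSign l i) • localOp i (S.opZ i))
        * S.condState l).trace
      = ∑ i with i ≠ 0, ((localOp 0 (S.opZ 0) * localOp 0 (S.opZ 0) * S.condState l).trace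
          + (localOp i (S.opZ i) * localOp i (S.opZ i) * S.condState l).trace)
        - 2 * ∑ i with i ≠ 0, (bitSign l 0 * bitSign l i)
            * (localOp 0 (S.opZ 0) * localOp i (S.opZ i) * S.condState l).trace := by
    rw [Finset.mul_sum, ← Finset.sum_sub_distrib]
    refine Finset.sum_congr rfl fun i hi => ?_
    rw [trace_sub_smul_sq_mul (localOp_comm (Finset.mem_filter.mp hi).2.symm _ _) (hs i)]
    ring
  rw [sosDefect, trace_sub_smul_sq_mul (S.localOp_comm_restX _) (bitSign_mul_self l 0), hsum,
    trace_bellOp_mul]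
  ring

theorem localOp_opX_transpose (i : Fin N) :
    (localOp i (S.opX i)).transpose = localOp i (S.opX i) := by
  rw [localOp_transpose, opX_transpose]

theorem localOp_opZ_transpose (i : Fin N) :
    (localOp i (S.opZ i)).transpose = localOp i (S.opZ i) := by
  rw [localOp_transpose, opZ_transpose]

omit [NeZero N] in
theorem sum_trace_mul_condState (K : S.OpA) :
    ∑ l, (K * S.condState l).trace = (K * tensorOp S.redState).trace := by
  rw [← Matrix.trace_sum, ← Matrix.mul_sum, sum_condState]

theorem trace_restX_sq :
    (S.restX * S.restX * tensorOp S.redState).trace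
      = ∏ i with i ≠ 0, (S.A i 1 * S.A i 1 * S.redState i).trace := by
  rw [restX, tensorOp_mul, tensorOp_mul, tensorOp_trace, Finset.prod_filter]
  refine Finset.prod_congr rfl fun i _ => ?_
  by_cases h : i = 0
  · simp [h, redState_trace]
  · simp [h, opX_of_ne]

variable {S}

/-- The left side is nonnegative and every bracket on the right is nonpositive, which forces all of
them to vanish. Summing over `l` is essential: only on the product state does the square of `restX`
factor into local terms. -/
theorem MaximalViolation.sum_sosDefect (hN : 2 ≤ N) (hS : S.MaximalViolation) :
    ∑ l, S.sosDefect l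
      = ((N : ℝ) - 1) * ((S.A 0 0 * S.A 0 0 * S.redState 0).trace - 1
          + ((S.A 0 1 * S.A 0 1 * S.redState 0).trace - 1)
          + (∏ i with i ≠ 0, (S.A i 1 * S.A i 1 * S.redState i).trace - 1))
        + ∑ i with i ≠ 0, ((S.A i 0 * S.A i 0 * S.redState i).trace - 1) := by
  have h1 : ∀ l, S.sosDefect l = ((N : ℝ) - 1)
        * ((localOp 0 (S.opX 0) * localOp 0 (S.opX 0) * S.condState l).trace
          + (S.restX * S.restX * S.condState l).trace)
        + (((N : ℝ) - 1) * (localOp 0 (S.opZ 0) * localOp 0 (S.opZ 0) * S.condState l).trace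
          + ∑ i with i ≠ 0, (localOp i (S.opZ i) * localOp i (S.opZ i) * S.condState l).trace)
        - 4 * ((N : ℝ) - 1) * (S.condState l).trace := by
    intro l
    have hc (c : ℝ) : ∑ i : Fin N with i ≠ 0, c = ((N : ℝ) - 1) * c := by
      rw [← sum_ne_zero_one, Finset.sum_mul, one_mul]
    rw [sosDefect_eq, hS.trace_bellOp hN, Finset.sum_add_distrib, hc]
    ring
  have h2 : (S.opX 0 * S.opX 0 * S.redState 0).trace + (S.opZ 0 * S.opZ 0 * S.redState 0).trace
      = (S.A 0 0 * S.A 0 0 * S.redState 0).trace + (S.A 0 1 * S.A 0 1 * S.redState 0).trace := by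
    rw [← Matrix.trace_add, ← Matrix.add_mul, opX_sq_add_opZ_sq_zero, Matrix.add_mul,
      Matrix.trace_add]
  have h3 : ∑ i : Fin N with i ≠ 0, (S.opZ i * S.opZ i * S.redState i).trace
      = ∑ i with i ≠ 0, (S.A i 0 * S.A i 0 * S.redState i).trace :=
    Finset.sum_congr rfl fun i hi => by rw [opZ_of_ne _ (Finset.mem_filter.mp hi).2]
  simp only [h1]
  rw [Finset.sum_sub_distrib, Finset.sum_add_distrib, Finset.sum_add_distrib, ← Finset.mul_sum,
    ← Finset.mul_sum, ← Finset.mul_sum, Finset.sum_add_distrib, Finset.sum_comm,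
    sum_trace_condState, sum_trace_mul_condState, sum_trace_mul_condState,
    sum_trace_mul_condState]
  simp only [sum_trace_mul_condState, ← localOp_mul, trace_localOp_mul_redState, trace_restX_sq]
  rw [h3, Finset.sum_sub_distrib, sum_ne_zero_one]
  linear_combination ((N : ℝ) - 1) * h2

theorem sosDefect_terms_nonneg (l : Fin N → Fin 2) :
    0 ≤ ((localOp 0 (S.opX 0) - bitSign l 0 • S.restX)
      * (localOp 0 (S.opX 0) - bitSign l 0 • S.restX) * S.condState l).trace ∧
    ∀ i, 0 ≤ ((localOp 0 (S.opZ 0) - (bitSign l 0 * bitSign l i) • localOp i (S.opZ i))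
        * (localOp 0 (S.opZ 0) - (bitSign l 0 * bitSign l i) • localOp i (S.opZ i))
        * S.condState l).trace :=
  ⟨(S.condState_posSemidef l).trace_sq_nonneg
      (sub_smul_transpose (S.localOp_opX_transpose 0) S.restX_transpose _),
    fun i => (S.condState_posSemidef l).trace_sq_nonneg
      (sub_smul_transpose (S.localOp_opZ_transpose 0) (S.localOp_opZ_transpose i) _)⟩

theorem sosDefect_nonneg (l : Fin N → Fin 2) : 0 ≤ S.sosDefect l := by
  have hm : (0 : ℝ) ≤ (N : ℝ) - 1 := by
    rw [← sum_ne_zero_one]; exact Finset.sum_nonneg fun _ _ => zero_le_one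
  exact add_nonneg (mul_nonneg hm (sosDefect_terms_nonneg l).1)
    (Finset.sum_nonneg fun i _ => (sosDefect_terms_nonneg l).2 i)

theorem prod_trace_sq_le_one : ∏ i with i ≠ 0, (S.A i 1 * S.A i 1 * S.redState i).trace ≤ 1 :=
  Finset.prod_le_one (fun i _ => S.trace_A_sq_nonneg i 1) fun i _ => S.trace_A_sq_le i 1

/-- The deficits of all squared observables vanish. -/
theorem MaximalViolation.deficits (hN : 2 ≤ N) (hS : S.MaximalViolation) :
    (∀ l, S.sosDefect l = 0) ∧ (S.A 0 0 * S.A 0 0 * S.redState 0).trace = 1 ∧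
    (S.A 0 1 * S.A 0 1 * S.redState 0).trace = 1 ∧
    ∏ i with i ≠ 0, (S.A i 1 * S.A i 1 * S.redState i).trace = 1 ∧
    ∀ i, i ≠ 0 → (S.A i 0 * S.A i 0 * S.redState i).trace = 1 := by
  have hm : (0 : ℝ) < (N : ℝ) - 1 := by
    have : (2 : ℝ) ≤ N := by exact_mod_cast hN
    linarith
  have h := hS.sum_sosDefect hN
  have h0 : 0 ≤ ∑ l, S.sosDefect l := Finset.sum_nonneg fun l _ => sosDefect_nonneg l
  have a := S.trace_A_sq_le 0 0
  have b := S.trace_A_sq_le 0 1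
  have c := prod_trace_sq_le_one (S := S)
  have hd : ∀ i ∈ Finset.univ.filter (fun i : Fin N => i ≠ 0),
      (S.A i 0 * S.A i 0 * S.redState i).trace - 1 ≤ 0 := fun i _ => by
    linarith [S.trace_A_sq_le i 0]
  have d := Finset.sum_nonpos hd
  set α := (S.A 0 0 * S.A 0 0 * S.redState 0).trace
  set β := (S.A 0 1 * S.A 0 1 * S.redState 0).trace
  set γ := ∏ i with i ≠ 0, (S.A i 1 * S.A i 1 * S.redState i).trace
  have h1 : 0 ≤ (N - 1) * (α - 1 + (β - 1) + (γ - 1)) := by linarith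
  have h2 : 0 ≤ α - 1 + (β - 1) + (γ - 1) := by
    by_contra hneg
    push Not at hneg
    linarith [mul_neg_of_pos_of_neg hm hneg]
  have hα : α = 1 := by linarith
  have hβ : β = 1 := by linarith
  have hγ : γ = 1 := by linarith
  rw [hα, hβ, hγ] at h
  have hsum : ∑ i with i ≠ 0, ((S.A i 0 * S.A i 0 * S.redState i).trace - 1) = 0 := by linarith
  refine ⟨fun l => ?_, hα, hβ, hγ, fun i hi => ?_⟩
  · exact (Finset.sum_eq_zero_iff_of_nonneg fun l _ => sosDefect_nonneg l).mp (by linarith) l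
      (Finset.mem_univ l)
  · have := (Finset.sum_eq_zero_iff_of_nonpos hd).mp hsum i (by simpa using hi)
    linarith

theorem eq_one_of_prod_eq_one {ι : Type*} (s : Finset ι) (f : ι → ℝ) (h0 : ∀ i ∈ s, 0 ≤ f i)
    (h1 : ∀ i ∈ s, f i ≤ 1) (h : ∏ i ∈ s, f i = 1) : ∀ i ∈ s, f i = 1 := by
  classical
  intro i hi
  rw [← Finset.mul_prod_erase s f hi] at h
  have : ∏ j ∈ s.erase i, f j ≤ 1 := Finset.prod_le_one
    (fun j hj => h0 j (Finset.mem_of_mem_erase hj)) fun j hj => h1 j (Finset.mem_of_mem_erase hj)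
  nlinarith [h0 i hi, h1 i hi]

theorem MaximalViolation.A_sq (hN : 2 ≤ N) (hS : S.MaximalViolation) (i : Fin N) :
    S.A i 0 * S.A i 0 * S.redState i = S.redState i ∧
    S.A i 1 * S.A i 1 * S.redState i = S.redState i := by
  obtain ⟨-, hα, hβ, hγ, hz⟩ := hS.deficits hN
  by_cases h : i = 0
  · subst h
    exact ⟨S.A_sq_mul_redState 0 0 hα, S.A_sq_mul_redState 0 1 hβ⟩
  · refine ⟨S.A_sq_mul_redState i 0 (hz i h), S.A_sq_mul_redState i 1 ?_⟩
    exact eq_one_of_prod_eq_one _ _ (fun j _ => S.trace_A_sq_nonneg j 1)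
      (fun j _ => S.trace_A_sq_le j 1) hγ i (by simpa using h)

/-- On each conditional state, the operators of the distinguished party are those of the others. -/
theorem MaximalViolation.localOp_mul_condState (hN : 2 ≤ N) (hS : S.MaximalViolation)
    (l : Fin N → Fin 2) :
    localOp 0 (S.opX 0) * S.condState l = bitSign l 0 • (S.restX * S.condState l) ∧
    ∀ i, i ≠ 0 → localOp 0 (S.opZ 0) * S.condState l
      = (bitSign l 0 * bitSign l i) • (localOp i (S.opZ i) * S.condState l) := by
  have hm : (0 : ℝ) < (N : ℝ) - 1 := by
    have : (2 : ℝ) ≤ N := by exact_mod_cast hN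
    linarith
  have h := (hS.deficits hN).1 l
  obtain ⟨hx, hz⟩ := sosDefect_terms_nonneg (S := S) l
  have hz' := Finset.sum_nonneg fun i (_ : i ∈ Finset.univ.filter (fun i : Fin N => i ≠ 0)) => hz i
  rw [sosDefect] at h
  have h1 := mul_nonneg hm.le hx
  have hX := (mul_eq_zero.mp (le_antisymm (by linarith) h1)).resolve_left hm.ne'
  rw [hX, mul_zero, zero_add] at h
  refine ⟨?_, fun i hi => ?_⟩
  · have := (S.condState_posSemidef l).mul_eq_zero_of_trace_sq
      (sub_smul_transpose (S.localOp_opX_transpose 0) S.restX_transpose _) hX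
    rwa [Matrix.sub_mul, Matrix.smul_mul, sub_eq_zero] at this
  · have hZ := (Finset.sum_eq_zero_iff_of_nonneg fun i _ => hz i).mp h i (by simpa using hi)
    have := (S.condState_posSemidef l).mul_eq_zero_of_trace_sq
      (sub_smul_transpose (S.localOp_opZ_transpose 0) (S.localOp_opZ_transpose i) _) hZ
    rwa [Matrix.sub_mul, Matrix.smul_mul, sub_eq_zero] at this

end RealStarNetwork

/-! ### Traces of Pauli words -/

section PauliTrace

variable {n : Type*} [Fintype n] {X Z r : Matrix n n ℝ}

/-- Conjugation by the involution `X`, which commutes with `r`, preserves the trace but flips the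
sign of `Z`. -/
theorem trace_opZ_eq_zero (hX : X * X * r = r) (hXr : X * r = r * X)
    (hXZ : X * Z * r = -(Z * X * r)) : (Z * r).trace = 0 := by
  have hrX : r * X * X = r := by
    rw [← hXr, Matrix.mul_assoc, ← hXr, ← Matrix.mul_assoc, hX]
  have h : (Z * r).trace = -(Z * r).trace := by
    calc (Z * r).trace = (Z * (X * X * r)).trace := by rw [hX]
      _ = (Z * X * r * X).trace := by rw [Matrix.mul_assoc X X r, hXr]; simp only [Matrix.mul_assoc]
      _ = (X * (Z * X * r)).trace := Matrix.trace_mul_comm _ _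
      _ = -(X * (X * Z * r)).trace := by rw [hXZ, Matrix.mul_neg, Matrix.trace_neg, neg_neg]
      _ = -(X * X * (Z * r)).trace := by simp only [Matrix.mul_assoc]
      _ = -(Z * (r * X * X)).trace := by rw [Matrix.trace_mul_comm]; simp only [Matrix.mul_assoc]
      _ = -(Z * r).trace := by rw [hrX]
  linarith

theorem trace_opXZ_eq_zero (hXr : X * r = r * X)
    (hXZ : X * Z * r = -(Z * X * r)) : (X * (Z * r)).trace = 0 := by
  have h : (X * (Z * r)).trace = -(X * (Z * r)).trace := by
    calc (X * (Z * r)).trace = -(Z * X * r).trace := by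
          rw [← Matrix.mul_assoc, hXZ, Matrix.trace_neg]
      _ = -(Z * r * X).trace := by rw [Matrix.mul_assoc, hXr, Matrix.mul_assoc]
      _ = -(X * (Z * r)).trace := by rw [Matrix.trace_mul_comm]
  linarith

/-- Powers occur because party `0` collects one `Z` from each stabilizer; `Z²` acts as the identity,
so only exponents `0` and `1` matter. -/
theorem trace_opX_mul_pow_eq_zero [DecidableEq n] (hZ : Z * Z * r = r) (hXr : X * r = r * X)
    (hZr : Z * r = r * Z) (hXZ : X * Z * r = -(Z * X * r)) (k : ℕ) :
    (X * (Z ^ k * r)).trace = 0 := by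
  induction k using Nat.twoStepInduction with
  | zero =>
    rw [pow_zero, Matrix.one_mul]
    exact trace_opZ_eq_zero hZ hZr (by rw [hXZ, neg_neg])
  | one => rw [pow_one]; exact trace_opXZ_eq_zero hXr hXZ
  | more k h _ => rw [pow_add, pow_two, Matrix.mul_assoc, hZ, h]

/-- A real symmetric operator has no component along the Pauli `Y`. -/
theorem trace_symm_mul_opX_mul_opZ_eq_zero {A : Matrix n n ℝ} (hA : A.transpose = A)
    (hXt : X.transpose = X) (hZt : Z.transpose = Z) (hrt : r.transpose = r)
    (hXr : X * r = r * X) (hZr : Z * r = r * Z)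
    (hXZ : X * Z * r = -(Z * X * r)) : (A * (X * (Z * r))).trace = 0 := by
  have h : (A * (X * (Z * r))).trace = -(A * (X * (Z * r))).trace := by
    -- Transposition reverses `X Z` and fixes `A`, while anticommutation turns the reversal into a
    -- sign. A complex Hermitian `A` such as Pauli `Y` would escape this.
    calc (A * (X * (Z * r))).trace = (A * (X * (Z * r))).transpose.trace :=
          (Matrix.trace_transpose _).symm
      _ = (r * Z * X * A).trace := by simp only [Matrix.transpose_mul, hA, hXt, hZt, hrt]
      _ = (A * (Z * X * r)).trace := by
        rw [Matrix.trace_mul_comm, ← hZr, Matrix.mul_assoc Z r X, ← hXr, Matrix.mul_assoc Z X r]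
      _ = -(A * (X * (Z * r))).trace := by
        rw [← Matrix.mul_assoc X, hXZ, Matrix.mul_neg, Matrix.trace_neg, neg_neg]
  linarith

/-- Cauchy-Schwarz for the `X`-component of a contraction. -/
theorem trace_mul_opX_sq_le {A : Matrix n n ℝ} (hr : r.PosSemidef) (hr1 : r.trace = 1)
    (hA : A.transpose = A) (hXt : X.transpose = X) (hX : X * X * r = r) (hXr : X * r = r * X)
    (hA1 : (A * A * r).trace ≤ 1) : (A * (X * r)).trace ^ 2 ≤ 1 := by
  set q := (A * (X * r)).trace with hq
  have hsq (s : ℝ) : ((A - s • X) * (A - s • X) * r).trace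
      = (A * A * r).trace - 2 * s * q + s ^ 2 := by
    have h1 : (X * A * r).trace = q := by
      rw [Matrix.mul_assoc, Matrix.trace_mul_comm, Matrix.mul_assoc, ← hXr]
    have h2 : (A - s • X) * (A - s • X) * r
        = A * A * r - s • (A * (X * r)) - s • (X * A * r) + (s * s) • (X * X * r) := by
      rw [sub_mul, mul_sub, mul_sub, smul_mul_smul_comm, Matrix.mul_smul, Matrix.smul_mul]
      simp only [Matrix.sub_mul, Matrix.smul_mul, Matrix.mul_assoc]
      abel
    rw [h2, hX]
    simp only [Matrix.trace_sub, Matrix.trace_add, Matrix.trace_smul, smul_eq_mul, h1, ← hq, hr1]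
    ring
  -- `s = q` minimizes the quadratic and leaves `q² ≤ tr (A² r)`.
  have := hr.trace_sq_nonneg (sub_smul_transpose hA hXt q)
  rw [hsq] at this
  nlinarith

end PauliTrace

/-! ### Passing between local, product and conditional states -/

theorem localOp_mul_tensorOp_cancel {N : ℕ} {d : Fin N → ℕ} {i : Fin N}
    {K L : Matrix (Fin (d i)) (Fin (d i)) ℝ} {M : ∀ i, Matrix (Fin (d i)) (Fin (d i)) ℝ}
    (hM : ∀ j, j ≠ i → (M j).trace = 1)
    (h : localOp i K * tensorOp M = localOp i L * tensorOp M) : K * M i = L * M i := by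
  refine Matrix.ext_iff_trace_mul_left.mpr fun J => ?_
  rw [← Matrix.mul_assoc, ← Matrix.mul_assoc, ← localOp_trace_mul i _ M hM,
    ← localOp_trace_mul i _ M hM, localOp_mul, localOp_mul, Matrix.mul_assoc, h, Matrix.mul_assoc]

theorem localOp_mul_tensorOp {N : ℕ} {d : Fin N → ℕ} (i : Fin N)
    (K : Matrix (Fin (d i)) (Fin (d i)) ℝ) (M : ∀ i, Matrix (Fin (d i)) (Fin (d i)) ℝ) :
    localOp i K * tensorOp M = tensorOp (Function.update M i (K * M i)) := by
  rw [localOp, tensorOp_mul]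
  congr 1
  ext1 j
  by_cases h : j = i
  · subst h; simp
  · simp [h]

/-- If a product of local involutions commutes with a product state, so does every factor. -/
theorem comm_of_tensorOp_comm {N : ℕ} {d : Fin N → ℕ}
    {U r : ∀ i, Matrix (Fin (d i)) (Fin (d i)) ℝ} (hr : ∀ i, (r i).trace = 1)
    (hU : ∀ i, U i * U i * r i = r i) (h : tensorOp U * tensorOp r = tensorOp r * tensorOp U)
    (i : Fin N) : U i * r i = r i * U i := by
  -- A second `U j` at every other site gives those factors trace one on both sides, so they can be
  -- traced out.
  have h1 := congrArg (fun K => tensorOp (fun j => if j = i then 1 else U j) * K) h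
  simp only [tensorOp_mul] at h1
  have h2 := eq_of_tensorOp_eq i h1
    (fun j hj => by simp only [hj, if_false]; rw [← Matrix.mul_assoc, hU, hr])
    (fun j hj => by
      simp only [hj, if_false]; rw [Matrix.trace_mul_comm, Matrix.mul_assoc, Matrix.trace_mul_comm,
        hU, hr])
  simpa using h2

namespace RealStarNetwork

variable {N : ℕ} {S : RealStarNetwork N}

/-- What annihilates the joint state annihilates every conditional state. -/
theorem mul_condState_eq_of_mul_redState_eq {K L : S.OpA}
    (h : K * tensorOp S.redState = L * tensorOp S.redState) (l : Fin N → Fin 2) :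
    K * S.condState l = L * S.condState l := by
  -- The summands are nonnegative, so the vanishing of their sum on the product state makes each one
  -- vanish.
  have h0 : ∑ l, ((K - L) * S.condState l * (K - L).transpose).trace = 0 := by
    rw [← Matrix.trace_sum, ← Matrix.sum_mul, ← Matrix.mul_sum, sum_condState, Matrix.sub_mul, h,
      sub_self, Matrix.zero_mul, Matrix.trace_zero]
  have h1 := (Finset.sum_eq_zero_iff_of_nonneg fun l _ =>
    (S.condState_posSemidef l).trace_conj_nonneg (K - L)).mp h0 l (Finset.mem_univ l)
  have h2 := (S.condState_posSemidef l).mul_eq_zero_of_trace h1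
  rwa [Matrix.sub_mul, sub_eq_zero] at h2

theorem mul_redState_eq_of_mul_condState_eq {K L : S.OpA}
    (h : ∀ l, K * S.condState l = L * S.condState l) :
    K * tensorOp S.redState = L * tensorOp S.redState := by
  rw [← sum_condState, Matrix.mul_sum, Matrix.mul_sum]
  exact Finset.sum_congr rfl fun l _ => h l

variable [NeZero N]

/-! ### Local Pauli relations forced by maximal violation -/

namespace MaximalViolation

theorem restX_sq (hN : 2 ≤ N) (hS : S.MaximalViolation) (l : Fin N → Fin 2) :
    S.restX * S.restX * S.condState l = S.condState l := by
  rw [← Matrix.one_mul (S.condState l), ← Matrix.mul_assoc]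
  refine mul_condState_eq_of_mul_redState_eq ?_ l
  rw [Matrix.mul_one, Matrix.one_mul, restX, tensorOp_mul, tensorOp_mul]
  congr 1
  ext1 i
  by_cases h : i = 0
  · simp [h]
  · simp [h, opX_of_ne, (hS.A_sq hN i).2]

theorem localOp_opZ_sq (hN : 2 ≤ N) (hS : S.MaximalViolation) (l : Fin N → Fin 2) {i : Fin N}
    (hi : i ≠ 0) : localOp i (S.opZ i) * localOp i (S.opZ i) * S.condState l = S.condState l := by
  rw [← Matrix.one_mul (S.condState l), ← Matrix.mul_assoc]
  refine mul_condState_eq_of_mul_redState_eq ?_ l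
  rw [Matrix.mul_one, Matrix.one_mul, ← localOp_mul, localOp_mul_tensorOp, opZ_of_ne _ hi,
    (hS.A_sq hN i).1, Function.update_eq_self]

theorem restX_mul_condState (hN : 2 ≤ N) (hS : S.MaximalViolation) (l : Fin N → Fin 2) :
    S.restX * S.condState l = bitSign l 0 • (localOp 0 (S.opX 0) * S.condState l) := by
  rw [(hS.localOp_mul_condState hN l).1, smul_smul, bitSign_mul_self, one_smul]

theorem localOp_opZ_mul_condState (hN : 2 ≤ N) (hS : S.MaximalViolation) (l : Fin N → Fin 2)
    {i : Fin N} (hi : i ≠ 0) : localOp i (S.opZ i) * S.condState l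
      = (bitSign l 0 * bitSign l i) • (localOp 0 (S.opZ 0) * S.condState l) := by
  rw [(hS.localOp_mul_condState hN l).2 i hi, smul_smul, mul_mul_mul_comm, bitSign_mul_self,
    bitSign_mul_self, one_mul, one_smul]

/-- The joint `X` operator stabilizes the conditional states up to sign. -/
theorem tensorOp_opX_mul_condState (hN : 2 ≤ N) (hS : S.MaximalViolation) (l : Fin N → Fin 2) :
    tensorOp S.opX * S.condState l = bitSign l 0 • S.condState l := by
  rw [← localOp_mul_restX, localOp_comm_restX, Matrix.mul_assoc,
    (hS.localOp_mul_condState hN l).1, Matrix.mul_smul, ← Matrix.mul_assoc, hS.restX_sq hN]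

/-- The operators `Z ⊗ Z` stabilize the conditional states up to sign. -/
theorem localOp_opZ_opZ_mul_condState (hN : 2 ≤ N) (hS : S.MaximalViolation)
    (l : Fin N → Fin 2) {i : Fin N} (hi : i ≠ 0) :
    localOp 0 (S.opZ 0) * localOp i (S.opZ i) * S.condState l
      = (bitSign l 0 * bitSign l i) • S.condState l := by
  rw [localOp_comm hi.symm, Matrix.mul_assoc, (hS.localOp_mul_condState hN l).2 i hi,
    Matrix.mul_smul, ← Matrix.mul_assoc, hS.localOp_opZ_sq hN l hi]

/-- For party `0` the operator is a combination of two observables, so the square is not given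
directly: it is transferred from `restX`, which acts on each `σ l` as `X 0` up to sign. -/
theorem opX_sq (hN : 2 ≤ N) (hS : S.MaximalViolation) (i : Fin N) :
    S.opX i * S.opX i * S.redState i = S.redState i := by
  by_cases h : i = 0
  · subst h
    rw [← Matrix.one_mul (S.redState 0), ← Matrix.mul_assoc, Matrix.mul_one]
    refine localOp_mul_tensorOp_cancel (fun j _ => S.redState_trace j) ?_
    refine mul_redState_eq_of_mul_condState_eq fun l => ?_
    rw [localOp_mul, Matrix.mul_assoc, (hS.localOp_mul_condState hN l).1, Matrix.mul_smul,
      ← Matrix.mul_assoc, localOp_comm_restX, Matrix.mul_assoc,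
      (hS.localOp_mul_condState hN l).1, Matrix.mul_smul, smul_smul, bitSign_mul_self, one_smul,
      ← Matrix.mul_assoc, hS.restX_sq hN, localOp, Function.update_eq_self, tensorOp_one,
      Matrix.one_mul]
  · rw [opX_of_ne _ h, (hS.A_sq hN i).2]

theorem opZ_sq (hN : 2 ≤ N) (hS : S.MaximalViolation) (i : Fin N) :
    S.opZ i * S.opZ i * S.redState i = S.redState i := by
  by_cases h : i = 0
  · subst h
    have h1 : S.opZ 0 * S.opZ 0
        = S.A 0 0 * S.A 0 0 + S.A 0 1 * S.A 0 1 - S.opX 0 * S.opX 0 := by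
      rw [← opX_sq_add_opZ_sq_zero]; abel
    rw [h1, Matrix.sub_mul, Matrix.add_mul, (hS.A_sq hN 0).1, (hS.A_sq hN 0).2, hS.opX_sq hN]
    abel
  · rw [opZ_of_ne _ h, (hS.A_sq hN i).1]

theorem anticomm_zero (hN : 2 ≤ N) (hS : S.MaximalViolation) :
    (S.opX 0 * S.opZ 0 + S.opZ 0 * S.opX 0) * S.redState 0 = 0 := by
  rw [opX_mul_opZ_add_zero, Matrix.sub_mul, (hS.A_sq hN 0).1, (hS.A_sq hN 0).2, sub_self]

/-- On each `σ l`, `restX` and `Z i` can be traded for `X 0` and `Z 0` in reversed order with a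
common sign, so the anticommutator of party `0` carries over. -/
theorem anticomm_restX (hN : 2 ≤ N) (hS : S.MaximalViolation) {i : Fin N} (hi : i ≠ 0) :
    (localOp i (S.opZ i) * S.restX + S.restX * localOp i (S.opZ i)) * tensorOp S.redState = 0 := by
  rw [← Matrix.zero_mul (tensorOp S.redState)]
  refine mul_redState_eq_of_mul_condState_eq fun l => ?_
  have h1 : localOp i (S.opZ i) * (S.restX * S.condState l)
      = (bitSign l 0 * (bitSign l 0 * bitSign l i))
        • (localOp 0 (S.opX 0) * localOp 0 (S.opZ 0) * S.condState l) := by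
    rw [hS.restX_mul_condState hN, Matrix.mul_smul, ← Matrix.mul_assoc, localOp_comm hi,
      Matrix.mul_assoc, hS.localOp_opZ_mul_condState hN l hi, Matrix.mul_smul, smul_smul,
      Matrix.mul_assoc]
  have h2 : S.restX * (localOp i (S.opZ i) * S.condState l)
      = (bitSign l 0 * (bitSign l 0 * bitSign l i))
        • (localOp 0 (S.opZ 0) * localOp 0 (S.opX 0) * S.condState l) := by
    rw [hS.localOp_opZ_mul_condState hN l hi, Matrix.mul_smul, ← Matrix.mul_assoc,
      ← localOp_comm_restX, Matrix.mul_assoc, hS.restX_mul_condState hN, Matrix.mul_smul,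
      smul_smul, Matrix.mul_assoc, mul_comm (bitSign l 0 * bitSign l i)]
  have h3 : localOp 0 (S.opX 0 * S.opZ 0 + S.opZ 0 * S.opX 0) * S.condState l
      = 0 * S.condState l := by
    refine mul_condState_eq_of_mul_redState_eq ?_ l
    rw [localOp_mul_tensorOp, hS.anticomm_zero hN, Matrix.zero_mul]
    ext a b
    rw [tensorOp_apply]
    exact Finset.prod_eq_zero (Finset.mem_univ 0) (by simp)
  rw [Matrix.add_mul, Matrix.mul_assoc, Matrix.mul_assoc, h1, h2, ← smul_add, ← Matrix.add_mul,
    ← localOp_mul, ← localOp_mul, ← localOp_add, h3, Matrix.zero_mul, smul_zero]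

theorem anticomm (hN : 2 ≤ N) (hS : S.MaximalViolation) (i : Fin N) :
    S.opX i * S.opZ i * S.redState i = -(S.opZ i * S.opX i * S.redState i) := by
  by_cases h : i = 0
  · subst h
    rw [eq_neg_iff_add_eq_zero, ← Matrix.add_mul, hS.anticomm_zero hN]
  -- Multiplying by `X j` at all remaining sites squares away their factors and isolates party `i`.
  · have h1 := congrArg
      (fun K => tensorOp (fun j => if j = 0 ∨ j = i then 1 else S.opX j) * K)
      (hS.anticomm_restX hN h)
    simp only [restX, localOp, tensorOp_mul, Matrix.add_mul, Matrix.mul_add, Matrix.mul_zero] at h1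
    have h2 := add_eq_zero_of_tensorOp_add_eq_zero i h1
      (fun j hj => by
        by_cases hj0 : j = 0
        · subst hj0; simp [hj, redState_trace]
        · simp [hj, hj0, ← Matrix.mul_assoc, hS.opX_sq hN, redState_trace])
      (fun j hj => by
        by_cases hj0 : j = 0
        · subst hj0; simp [hj, redState_trace]
        · simp [hj, hj0, ← Matrix.mul_assoc, hS.opX_sq hN, redState_trace])
    simp only [h, or_true, if_true, if_false, Function.update_self, Matrix.one_mul] at h2
    rw [eq_neg_iff_add_eq_zero, add_comm, h2]

omit [NeZero N] in
-- Transposing the eigenvalue equation gives the same equation from the right, since `K` and `σ l`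
-- are symmetric; then sum over `l`.
theorem comm_redState_of_stabilizer {K : S.OpA} (hK : K.transpose = K)
    {c : (Fin N → Fin 2) → ℝ} (h : ∀ l, K * S.condState l = c l • S.condState l) :
    K * tensorOp S.redState = tensorOp S.redState * K := by
  rw [← sum_condState, Matrix.mul_sum, Matrix.sum_mul]
  refine Finset.sum_congr rfl fun l _ => ?_
  have := congrArg Matrix.transpose (h l)
  rw [Matrix.transpose_mul, Matrix.transpose_smul, (S.condState_posSemidef l).transpose_eq,
    hK] at this
  rw [h, this]

theorem opX_comm (hN : 2 ≤ N) (hS : S.MaximalViolation) (i : Fin N) :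
    S.opX i * S.redState i = S.redState i * S.opX i := by
  refine comm_of_tensorOp_comm S.redState_trace (hS.opX_sq hN) ?_ i
  refine comm_redState_of_stabilizer ?_ (hS.tensorOp_opX_mul_condState hN)
  rw [tensorOp_transpose]
  simp only [opX_transpose]

theorem opZ_comm (hN : 2 ≤ N) (hS : S.MaximalViolation) (i : Fin N) :
    S.opZ i * S.redState i = S.redState i * S.opZ i := by
  -- A stabilizer `Z 0 ⊗ Z j` that involves party `i`; for `i = 0` any partner works, and party `1`
  -- exists since `N ≥ 2`.
  obtain ⟨j, hj, hij⟩ : ∃ j : Fin N, j ≠ 0 ∧ (i = 0 ∨ i = j) := by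
    by_cases h : i = 0
    · exact ⟨⟨1, hN⟩, by simp [Fin.ext_iff], Or.inl h⟩
    · exact ⟨i, h, Or.inr rfl⟩
  have h1 : localOp 0 (S.opZ 0) * localOp j (S.opZ j)
      = tensorOp (fun k => if k = 0 ∨ k = j then S.opZ k else 1) := by
    rw [localOp_mul_localOp hj.symm]
    congr 1
    ext1 k
    by_cases hk : k = j
    · subst hk; simp
    · by_cases hk0 : k = 0
      · subst hk0; simp [hk]
      · simp [hk, hk0]
  have h2 := comm_redState_of_stabilizer (S := S)
    (K := tensorOp (fun k => if k = 0 ∨ k = j then S.opZ k else 1))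
    (by
      rw [tensorOp_transpose]
      congr 1
      ext1 k
      split_ifs
      · exact S.opZ_transpose k
      · simp)
    (fun l => by rw [← h1]; exact hS.localOp_opZ_opZ_mul_condState hN l hj)
  have h3 := comm_of_tensorOp_comm S.redState_trace (fun k => ?_) h2 i
  · simpa [hij] using h3
  · split_ifs
    · exact hS.opZ_sq hN k
    · simp

end MaximalViolation

end RealStarNetwork

/-! ### The Mermin functional on product expectations -/

/-- Expansion of a squared sum, with pairs containing `0` split off because the Mermin functional
lists them separately. -/
theorem two_mul_sum_pairs {N : ℕ} [NeZero N] (q : Fin N → ℝ) :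
    2 * (∑ p : Fin N × Fin N with p.1 ≠ 0 ∧ p.2 ≠ 0 ∧ p.1 < p.2, q p.1 * q p.2
      + ∑ j : Fin N with j ≠ 0, q 0 * q j) = (∑ i, q i) ^ 2 - ∑ i, q i ^ 2 := by
  have hlt : ∑ p : Fin N × Fin N with p.1 < p.2, q p.1 * q p.2
      = ∑ p : Fin N × Fin N with p.1 ≠ 0 ∧ p.2 ≠ 0 ∧ p.1 < p.2, q p.1 * q p.2
        + ∑ j : Fin N with j ≠ 0, q 0 * q j := by
    rw [← Finset.sum_filter_add_sum_filter_not (Finset.univ.filter fun p : Fin N × Fin N => p.1 < p.2)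
      (fun p => p.1 ≠ 0), Finset.filter_filter, Finset.filter_filter]
    congr 1
    · refine Finset.sum_congr (Finset.filter_congr fun p _ => ?_) fun _ _ => rfl
      constructor
      · rintro ⟨h, h0⟩
        exact ⟨h0, fun h2 => by rw [h2] at h; exact absurd h (Fin.not_lt_zero _), h⟩
      · rintro ⟨h0, -, h⟩
        exact ⟨h, h0⟩
    · refine Finset.sum_bij' (fun p _ => p.2) (fun j _ => (0, j)) ?_ ?_ ?_ ?_ ?_
      · rintro ⟨a, b⟩ h
        simp only [Finset.mem_filter, Finset.mem_univ, true_and, not_not] at h ⊢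
        exact (h.2 ▸ h.1).ne'
      · intro j hj
        simp only [Finset.mem_filter, Finset.mem_univ, true_and, not_not, and_true] at hj ⊢
        exact Fin.pos_iff_ne_zero.mpr hj
      · rintro ⟨a, b⟩ h
        simp only [Finset.mem_filter, Finset.mem_univ, true_and, not_not] at h
        simp [h.2]
      · intro j _; rfl
      · rintro ⟨a, b⟩ h
        simp only [Finset.mem_filter, Finset.mem_univ, true_and, not_not] at h
        simp [h.2]
  have hgt : ∑ p : Fin N × Fin N with p.2 < p.1, q p.1 * q p.2
      = ∑ p : Fin N × Fin N with p.1 < p.2, q p.1 * q p.2 := by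
    refine Finset.sum_bij' (fun p _ => p.swap) (fun p _ => p.swap) ?_ ?_ ?_ ?_ ?_ <;>
      simp +contextual [mul_comm]
  have heq : ∑ p : Fin N × Fin N with p.1 = p.2, q p.1 * q p.2 = ∑ i, q i ^ 2 := by
    rw [Finset.sum_filter, Fintype.sum_prod_type]
    simp [pow_two]
  have hsq : (∑ i, q i) ^ 2 = ∑ p : Fin N × Fin N, q p.1 * q p.2 := by
    rw [pow_two, Finset.sum_mul_sum, Fintype.sum_prod_type]
  rw [← hlt, hsq, ← heq]
  have hsplit : ∑ p : Fin N × Fin N, q p.1 * q p.2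
      = ∑ p : Fin N × Fin N with p.1 = p.2, q p.1 * q p.2
        + (∑ p : Fin N × Fin N with p.1 < p.2, q p.1 * q p.2
          + ∑ p : Fin N × Fin N with p.2 < p.1, q p.1 * q p.2) := by
    rw [Finset.sum_filter, Finset.sum_filter, Finset.sum_filter, ← Finset.sum_add_distrib,
      ← Finset.sum_add_distrib]
    refine Finset.sum_congr rfl fun p _ => ?_
    rcases lt_trichotomy p.1 p.2 with h | h | h
    · simp [h, h.ne, h.not_gt]
    · simp [h]
    · simp [h, h.ne', h.not_gt]
  rw [hsplit, hgt]
  ring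

namespace RealStarNetwork

variable {N : ℕ} [NeZero N] (S : RealStarNetwork N)

/-- The product of the third observables of parties `j`, `k` and the operators `X` of the others. -/
def pairOp (j k : Fin N) : S.OpA :=
  tensorOp (fun i => if i = j ∨ i = k then S.A i 2 else S.opX i)

theorem merminValue_eq_sum_pairOp :
    S.merminValue = -(2 / ((N : ℝ) * ((N : ℝ) - 1))) *
      (∑ p : Fin N × Fin N with p.1 ≠ 0 ∧ p.2 ≠ 0 ∧ p.1 < p.2,
          S.condExpect 0 (S.pairOp p.1 p.2)
        + ∑ j : Fin N with j ≠ 0, S.condExpect 0 (S.pairOp 0 j)) := by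
  unfold merminValue pairOp
  congr 2
  · refine Finset.sum_congr rfl fun p hp => ?_
    obtain ⟨h1, h2, -⟩ := (Finset.mem_filter.mp hp).2
    congr 2
    ext1 i
    by_cases hi : i = 0
    · subst hi; simp [h1.symm, h2.symm, opX]
    · simp [hi, opX]
  · refine Finset.sum_congr rfl fun j _ => ?_
    congr 2
    ext1 i
    by_cases hi : i = 0
    · simp [hi]
    · simp [hi, opX]

/-- The Mermin value when the pair expectations factorize. -/
theorem merminValue_eq {q : Fin N → ℝ}
    (h : ∀ j k, j ≠ k → S.condExpect 0 (S.pairOp j k) = q j * q k) :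
    S.merminValue = (∑ i, q i ^ 2 - (∑ i, q i) ^ 2) / ((N : ℝ) * ((N : ℝ) - 1)) := by
  have h1 := two_mul_sum_pairs q
  have h2 : ∑ p : Fin N × Fin N with p.1 ≠ 0 ∧ p.2 ≠ 0 ∧ p.1 < p.2,
      S.condExpect 0 (S.pairOp p.1 p.2)
      = ∑ p : Fin N × Fin N with p.1 ≠ 0 ∧ p.2 ≠ 0 ∧ p.1 < p.2, q p.1 * q p.2 :=
    Finset.sum_congr rfl fun p hp => h _ _ (Finset.mem_filter.mp hp).2.2.2.ne
  have h3 : ∑ j : Fin N with j ≠ 0, S.condExpect 0 (S.pairOp 0 j)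
      = ∑ j : Fin N with j ≠ 0, q 0 * q j :=
    Finset.sum_congr rfl fun j hj => h _ _ (Finset.mem_filter.mp hj).2.symm
  rw [merminValue_eq_sum_pairOp, h2, h3, ← neg_sub ((∑ i, q i) ^ 2), ← h1]
  ring

/-! ### Stabilizer expansion of the conditional state -/

/-- The product of the stabilizers `Z ⊗ Z` of the parties in `s` with the distinguished one. -/
def wordZ (s : Finset (Fin N)) : ∀ i, Matrix (Fin (S.dA i)) (Fin (S.dA i)) ℝ :=
  fun i => if i = 0 then S.opZ i ^ s.card else if i ∈ s then S.opZ i else 1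

variable {S}

namespace MaximalViolation

theorem wordZ_mul_condState (hN : 2 ≤ N) (hS : S.MaximalViolation) (l : Fin N → Fin 2)
    (s : Finset (Fin N)) (hs : 0 ∉ s) : tensorOp (S.wordZ s) * S.condState l
      = (∏ i ∈ s, bitSign l 0 * bitSign l i) • S.condState l := by
  induction s using Finset.induction_on with
  | empty =>
    have : S.wordZ ∅ = fun _ => 1 := by ext1 i; simp [wordZ]
    rw [this, tensorOp_one, Matrix.one_mul, Finset.prod_empty, one_smul]
  | insert i s hi ih =>
    have hi0 : i ≠ 0 := fun h => hs (h ▸ Finset.mem_insert_self i s)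
    have h : tensorOp (S.wordZ (insert i s))
        = tensorOp (S.wordZ s) * (localOp 0 (S.opZ 0) * localOp i (S.opZ i)) := by
      rw [localOp_mul_localOp hi0.symm, tensorOp_mul]
      congr 1
      ext1 j
      by_cases hji : j = i
      · subst hji; simp [wordZ, hi, hi0]
      · by_cases hj : j = 0
        · subst hj; simp [wordZ, hi, hi0.symm, pow_succ]
        · simp [wordZ, hj, hji]
    rw [h, Matrix.mul_assoc, hS.localOp_opZ_opZ_mul_condState hN l hi0, Matrix.mul_smul,
      ih fun h => hs (Finset.mem_insert_of_mem h), smul_smul, Finset.prod_insert hi]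

/-- The state conditioned on `0 … 0` is proportional to the sum of all stabilizers applied to the
product of the reduced states. -/
theorem exists_sum_word_mul_redState (hN : 2 ≤ N) (hS : S.MaximalViolation) : ∃ c : ℝ,
    ∑ s ∈ (Finset.univ.filter fun i : Fin N => i ≠ 0).powerset,
      (tensorOp (S.wordZ s) * tensorOp S.redState
        + tensorOp S.opX * (tensorOp (S.wordZ s) * tensorOp S.redState))
      = c • S.condState 0 := by
  set t := Finset.univ.filter fun i : Fin N => i ≠ 0 with ht
  -- The sum over words is the expansion of `(1 + ∏ X i) ∏ (1 + Z 0 Z i)`, so it acts on `σ l` by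
  -- the corresponding product of signs.
  have h1 : ∀ l, ∑ s ∈ t.powerset, (tensorOp (S.wordZ s) * S.condState l
        + tensorOp S.opX * (tensorOp (S.wordZ s) * S.condState l))
      = ((1 + bitSign l 0) * ∏ i ∈ t, (1 + bitSign l 0 * bitSign l i)) • S.condState l := by
    intro l
    rw [Finset.prod_one_add, Finset.mul_sum, Finset.sum_smul]
    refine Finset.sum_congr rfl fun s hs => ?_
    rw [hS.wordZ_mul_condState hN l s fun h => by
        simpa [ht] using Finset.mem_powerset.mp hs h,
      Matrix.mul_smul, hS.tensorOp_opX_mul_condState hN, smul_smul, ← add_smul]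
    congr 1
    ring
  refine ⟨(1 + bitSign (0 : Fin N → Fin 2) 0)
    * ∏ i ∈ t, (1 + bitSign (0 : Fin N → Fin 2) 0 * bitSign 0 i), ?_⟩
  rw [← h1 0, ← sum_condState]
  simp only [Matrix.mul_sum, ← Finset.sum_add_distrib]
  rw [Finset.sum_comm]
  refine Finset.sum_eq_single 0 (fun l _ hl => ?_) (by simp)
  rw [h1]
  -- If `l 0 = 0`, some other bit is `1` and kills its `Z` factor; if `l 0 = 1`, the `X` factor
  -- vanishes.
  by_cases hl0 : l 0 = 0
  · obtain ⟨i, hi⟩ := Function.ne_iff.mp hl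
    have hi1 : l i = 1 := by
      rcases Fin.exists_fin_two.mp ⟨l i, rfl⟩ with h | h
      · exact absurd h hi
      · exact h
    have hi0 : i ≠ 0 := by rintro rfl; exact hi hl0
    rw [Finset.prod_eq_zero (i := i) (by simp [ht, hi0]) (by simp [bitSign, hl0, hi1]), mul_zero,
      zero_smul]
  · have h01 : l 0 = 1 := by
      rcases Fin.exists_fin_two.mp ⟨l 0, rfl⟩ with h | h
      · exact absurd h hl0
      · exact h
    have : (1 : ℝ) + bitSign l 0 = 0 := by simp [bitSign, h01]
    rw [this, zero_mul, zero_smul]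

/-- Only the trivial word contributes to the expectation of products of third observables. -/
theorem trace_pairOp_word (hN : 2 ≤ N) (hS : S.MaximalViolation) {j k : Fin N} (hjk : j ≠ k)
    {i₀ : Fin N} (hj : i₀ ≠ j) (hk : i₀ ≠ k) (s : Finset (Fin N)) (hs : 0 ∉ s) :
    (S.pairOp j k * (tensorOp (S.wordZ s) * tensorOp S.redState
        + tensorOp S.opX * (tensorOp (S.wordZ s) * tensorOp S.redState))).trace
      = if s = ∅ then (S.A j 2 * (S.opX j * S.redState j)).trace
          * (S.A k 2 * (S.opX k * S.redState k)).trace else 0 := by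
  rw [Matrix.mul_add, Matrix.trace_add]
  -- Without the global `X`, the third party `i₀` contributes `tr (X Zᵐ r) = 0`.
  have h1 : (S.pairOp j k * (tensorOp (S.wordZ s) * tensorOp S.redState)).trace = 0 := by
    rw [pairOp, tensorOp_mul, tensorOp_mul, tensorOp_trace]
    refine Finset.prod_eq_zero (Finset.mem_univ i₀) ?_
    have (m : ℕ) := trace_opX_mul_pow_eq_zero (hS.opZ_sq hN i₀) (hS.opX_comm hN i₀)
      (hS.opZ_comm hN i₀) (hS.anticomm hN i₀) m
    simp only [hj, hk, or_self, if_false, wordZ]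
    split_ifs
    · exact this _
    · simpa using this 1
    · simpa using this 0
  have h2 : (S.pairOp j k * (tensorOp S.opX * (tensorOp (S.wordZ s)
      * tensorOp S.redState))).trace = if s = ∅ then (S.A j 2 * (S.opX j * S.redState j)).trace
          * (S.A k 2 * (S.opX k * S.redState k)).trace else 0 := by
    rw [pairOp, tensorOp_mul, tensorOp_mul, tensorOp_mul, tensorOp_trace]
    split_ifs with h
    · subst h
      have : S.wordZ ∅ = fun _ => 1 := by ext1 i; simp [wordZ]
      simp only [this, Matrix.one_mul]
      rw [← Finset.mul_prod_erase _ _ (Finset.mem_univ j),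
        ← Finset.mul_prod_erase _ _ (Finset.mem_erase.mpr ⟨hjk.symm, Finset.mem_univ k⟩),
        Finset.prod_eq_one fun i hi => ?_]
      · simp
      · simp only [Finset.mem_erase, Finset.mem_univ, and_true] at hi
        simp only [hi.1, hi.2, or_self, if_false]
        rw [← Matrix.mul_assoc, hS.opX_sq hN, redState_trace]
    -- A party `i ∈ s` holds a symmetric observable against `X Z`, that is, against Pauli `Y`, which
    -- reality excludes.
    · obtain ⟨i, hi⟩ := Finset.nonempty_iff_ne_empty.mpr h
      have hi0 : i ≠ 0 := by rintro rfl; exact hs hi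
      refine Finset.prod_eq_zero (Finset.mem_univ i) ?_
      simp only [wordZ, hi0, hi, if_false, if_true]
      refine trace_symm_mul_opX_mul_opZ_eq_zero ?_ (S.opX_transpose i) (S.opZ_transpose i)
        (S.redState_transpose i) (hS.opX_comm hN i) (hS.opZ_comm hN i) (hS.anticomm hN i)
      split_ifs
      · exact S.A_transpose i 2
      · exact S.opX_transpose i
  rw [h1, h2, zero_add]

/-- Trace of the stabilizer expansion itself. -/
theorem trace_word (hN : 2 ≤ N) (hS : S.MaximalViolation) (s : Finset (Fin N)) (hs : 0 ∉ s) :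
    (tensorOp (S.wordZ s) * tensorOp S.redState
        + tensorOp S.opX * (tensorOp (S.wordZ s) * tensorOp S.redState)).trace
      = if s = ∅ then 1 else 0 := by
  rw [Matrix.trace_add]
  have h1 : (tensorOp (S.wordZ s) * tensorOp S.redState).trace = if s = ∅ then 1 else 0 := by
    rw [tensorOp_mul, tensorOp_trace]
    split_ifs with h
    · subst h
      simp [wordZ, redState_trace]
    · obtain ⟨i, hi⟩ := Finset.nonempty_iff_ne_empty.mpr h
      have hi0 : i ≠ 0 := by rintro rfl; exact hs hi
      refine Finset.prod_eq_zero (Finset.mem_univ i) ?_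
      simp only [wordZ, hi0, hi, if_false, if_true]
      exact trace_opZ_eq_zero (hS.opX_sq hN i) (hS.opX_comm hN i) (hS.anticomm hN i)
  have h2 : (tensorOp S.opX * (tensorOp (S.wordZ s) * tensorOp S.redState)).trace = 0 := by
    rw [tensorOp_mul, tensorOp_mul, tensorOp_trace]
    refine Finset.prod_eq_zero (Finset.mem_univ 0) ?_
    simp only [wordZ, if_true]
    exact trace_opX_mul_pow_eq_zero (hS.opZ_sq hN 0) (hS.opX_comm hN 0)
      (hS.opZ_comm hN 0) (hS.anticomm hN 0) _
  rw [h1, h2, add_zero]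

/-- Factorization of the pair expectations: real states carry no correlations of Pauli `Y`s. -/
theorem condExpect_pairOp (hN : 2 ≤ N) (hS : S.MaximalViolation) {j k : Fin N} (hjk : j ≠ k)
    {i₀ : Fin N} (hj : i₀ ≠ j) (hk : i₀ ≠ k) : S.condExpect 0 (S.pairOp j k)
      = (S.A j 2 * (S.opX j * S.redState j)).trace
        * (S.A k 2 * (S.opX k * S.redState k)).trace := by
  obtain ⟨c, hc⟩ := hS.exists_sum_word_mul_redState hN
  have h0 : ∀ s ∈ (Finset.univ.filter fun i : Fin N => i ≠ 0).powerset, 0 ∉ s := fun s hs h => by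
    simpa using Finset.mem_powerset.mp hs h
  have h1 := congrArg Matrix.trace hc
  have h2 := congrArg (fun K => (S.pairOp j k * K).trace) hc
  simp only [Matrix.mul_sum, Matrix.trace_sum, Matrix.mul_smul, Matrix.trace_smul,
    smul_eq_mul] at h1 h2
  rw [Finset.sum_congr rfl fun s hs => hS.trace_word hN s (h0 s hs)] at h1
  rw [Finset.sum_congr rfl fun s hs => hS.trace_pairOp_word hN hjk hj hk s (h0 s hs)] at h2
  rw [Finset.sum_ite_eq' , if_pos (Finset.empty_mem_powerset _)] at h1 h2
  rw [condExpect_eq, h2, div_eq_iff (hS.trace_ne_zero hN 0)]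
  -- The constant `c` is never computed: the trace identity `1 = c * tr (σ 0)` is enough.
  linear_combination (S.pairOp j k * S.condState 0).trace * h1

/-! ### The upper bound -/

theorem merminValue_le_of_three_le (hN : 3 ≤ N) (hS : S.MaximalViolation) :
    S.merminValue ≤ 1 / ((N : ℝ) - 1) := by
  have hN2 : 2 ≤ N := by omega
  rw [S.merminValue_eq (q := fun i => (S.A i 2 * (S.opX i * S.redState i)).trace)]
  · have hsq : ∑ i, (S.A i 2 * (S.opX i * S.redState i)).trace ^ 2 ≤ N := by
      refine (Finset.sum_le_sum fun i _ => trace_mul_opX_sq_le (S.redState_posSemidef i)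
        (S.redState_trace i) (S.A_transpose i 2) (S.opX_transpose i) (hS.opX_sq hN2 i)
        (hS.opX_comm hN2 i) (S.trace_A_sq_le i 2)).trans ?_
      simp
    have h3 : (3 : ℝ) ≤ N := by exact_mod_cast hN
    rw [div_le_div_iff₀ (mul_pos (by linarith) (by linarith)) (by linarith), one_mul]
    have hm : (0 : ℝ) ≤ N - 1 := by linarith
    refine mul_le_mul_of_nonneg_right ?_ hm
    -- Drop `-(∑ q)²` and bound `∑ q²` by `N`.
    linarith [sq_nonneg (∑ i, (S.A i 2 * (S.opX i * S.redState i)).trace)]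
  · intro j k hjk
    obtain ⟨i₀, hi₀⟩ : ∃ i₀ : Fin N, i₀ ∉ ({j, k} : Finset (Fin N)) := by
      by_contra hall
      push Not at hall
      have h1 := Finset.card_le_card (fun i _ => hall i : Finset.univ ⊆ ({j, k} : Finset (Fin N)))
      have h2 := Finset.card_le_two (a := j) (b := k)
      rw [Finset.card_univ, Fintype.card_fin] at h1
      omega
    simp only [Finset.mem_insert, Finset.mem_singleton, not_or] at hi₀
    exact hS.condExpect_pairOp hN2 hjk hi₀.1 hi₀.2

end MaximalViolation

/-- With two parties the functional is bounded by its algebraic maximum. -/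
theorem neg_one_le_condExpect_A_A (S : RealStarNetwork 2) (l : Fin 2 → Fin 2) (x : Fin 3) :
    -1 ≤ S.condExpect l (tensorOp fun i => S.A i x) := by
  -- `1 + A ⊗ A` is twice the positive operator for equal outcomes.
  have hM : tensorOp (fun i => S.A i x) + 1
      = (2 : ℝ) • (tensorOp (fun i => S.M i x 0) + tensorOp (fun i => S.M i x 1)) := by
    have h1 : (1 : S.OpA) = tensorOp (fun i => S.M i x 0 + S.M i x 1) := by
      rw [← tensorOp_one]
      congr 1
      ext1 i
      simpa using (S.M_sum i x).symm
    rw [h1]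
    ext a b
    simp only [A, Matrix.add_apply, Matrix.smul_apply, tensorOp_apply, Matrix.sub_apply,
      Fin.prod_univ_two, smul_eq_mul]
    ring
  have h2 : 0 ≤ ((tensorOp (fun i => S.A i x) + 1) * S.condState l).trace := by
    rw [hM]
    exact (((tensorOp_posSemidef fun i => S.M_posSemidef i x 0).add
      (tensorOp_posSemidef fun i => S.M_posSemidef i x 1)).smul zero_le_two).trace_mul_nonneg
      (S.condState_posSemidef l)
  rw [Matrix.add_mul, Matrix.trace_add, Matrix.one_mul] at h2
  rw [condExpect_eq]
  rcases (S.condState_posSemidef l).trace_nonneg.eq_or_lt with h | h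
  · rw [← h, div_zero]; norm_num
  · rw [le_div_iff₀ h]; linarith

/-- There is no third party, so factorization is unavailable; but the functional is just minus one
two-party correlator. -/
theorem merminValue_le_of_two (S : RealStarNetwork 2) : S.merminValue ≤ 1 := by
  have h1 : (Finset.univ.filter fun p : Fin 2 × Fin 2 => p.1 ≠ 0 ∧ p.2 ≠ 0 ∧ p.1 < p.2) = ∅ := by
    decide
  have h2 : (Finset.univ.filter fun j : Fin 2 => j ≠ 0) = {1} := by decide
  have h3 : S.pairOp 0 1 = tensorOp fun i => S.A i 2 := by
    unfold pairOp
    congr 1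
    ext1 i
    rw [if_pos (Fin.exists_fin_two.mp ⟨i, rfl⟩)]
  rw [merminValue_eq_sum_pairOp, h1, h2, Finset.sum_empty, Finset.sum_singleton, h3]
  have := S.neg_one_le_condExpect_A_A 0 2
  norm_num
  linarith

theorem MaximalViolation.merminValue_le (hN : 2 ≤ N) (hS : S.MaximalViolation) :
    S.merminValue ≤ 1 / ((N : ℝ) - 1) := by
  rcases hN.eq_or_lt with h | h
  · subst h
    refine S.merminValue_le_of_two.trans ?_
    norm_num
  · exact hS.merminValue_le_of_three_le h

end RealStarNetwork

/-! ### A realization with qubits and a measurement in the GHZ basis -/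

namespace RealStarNetwork

section Qubits

/-- The observable `c X + s Z` of a qubit. -/
def qubitObs (c s : ℝ) : Matrix (Fin 2) (Fin 2) ℝ := !![s, c; c, -s]

/-- The effect of outcome `a` of the observable `c X + s Z`. -/
def qubitEffect (c s : ℝ) (a : Fin 2) : Matrix (Fin 2) (Fin 2) ℝ :=
  (1 / 2 : ℝ) • (1 + (-1 : ℝ) ^ (a : ℕ) • qubitObs c s)

/-- On the unit circle the observable squares to one, so the effect is an orthogonal projection. -/
theorem qubitEffect_posSemidef {c s : ℝ} (h : c ^ 2 + s ^ 2 = 1) (a : Fin 2) :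
    (qubitEffect c s a).PosSemidef := by
  have : qubitEffect c s a = (qubitEffect c s a).conjTranspose * qubitEffect c s a := by
    ext i j
    fin_cases a <;> fin_cases i <;> fin_cases j <;>
      simp [qubitEffect, qubitObs, Matrix.mul_apply, Fin.sum_univ_two] <;>
      first | ring1 | linear_combination (-1 / 4 : ℝ) * h
  rw [this]
  exact Matrix.posSemidef_conjTranspose_mul_self _

theorem qubitEffect_sum (c s : ℝ) : ∑ a, qubitEffect c s a = 1 := by
  rw [Fin.sum_univ_two, qubitEffect, qubitEffect, ← smul_add]
  simp only [Fin.val_zero, Fin.val_one, pow_zero, pow_one]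
  module

theorem qubitEffect_sub (c s : ℝ) : qubitEffect c s 0 - qubitEffect c s 1 = qubitObs c s := by
  simp only [qubitEffect, Fin.val_zero, Fin.val_one, pow_zero, pow_one]
  module

theorem smul_qubitObs (t c s : ℝ) : t • qubitObs c s = qubitObs (t * c) (t * s) := by
  ext i j
  fin_cases i <;> fin_cases j <;> simp [qubitObs]

theorem smul_qubitObs_add (t c s c' s' : ℝ) :
    t • (qubitObs c s + qubitObs c' s') = qubitObs (t * (c + c')) (t * (s + s')) := by
  rw [← smul_qubitObs]
  congr 1
  ext i j
  fin_cases i <;> fin_cases j <;> simp [qubitObs]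
  ring

theorem smul_qubitObs_sub (t c s c' s' : ℝ) :
    t • (qubitObs c s - qubitObs c' s') = qubitObs (t * (c - c')) (t * (s - s')) := by
  rw [← smul_qubitObs]
  congr 1
  ext i j
  fin_cases i <;> fin_cases j <;> simp [qubitObs]
  ring

/-- The coefficients of the observables of party `i` with respect to `X` and `Z`. -/
def starCoeff {N : ℕ} [NeZero N] (i : Fin N) : Fin 3 → ℝ × ℝ :=
  -- Party `0` measures `(X ± Z) / √2`, so that `tildeA1` and `tildeA0` become `X` and `Z`.
  if i = 0 then ![(1 / √2, 1 / √2), (1 / √2, -(1 / √2)), (1, 0)]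
  else ![(0, 1), (1, 0), ((-1) ^ (i : ℕ), 0)]

theorem starCoeff_sq {N : ℕ} [NeZero N] (i : Fin N) (x : Fin 3) :
    (starCoeff i x).1 ^ 2 + (starCoeff i x).2 ^ 2 = 1 := by
  have h := one_div_sqrt_two_mul_self
  have h' := neg_one_pow_eq_or ℝ (i : ℕ)
  unfold starCoeff
  split_ifs
  · fin_cases x <;> simp <;> norm_num
  · fin_cases x <;> simp [h']

/-- The maximally entangled state of two qubits, up to normalization, as a vector. -/
def bellVec (p : Fin 2 × Fin 2) : ℝ := if p.1 = p.2 then 1 else 0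

variable {N : ℕ} [NeZero N]

/-- The (unnormalized) GHZ basis vector with label `l`. -/
def ghzVec (l e : Fin N → Fin 2) : ℝ :=
  bitSign l 0 * (if e = l then 1 else 0) + if e = l + 1 then 1 else 0

omit [NeZero N] in
theorem fin_two_add_one_add_one (e : Fin N → Fin 2) : e + 1 + 1 = e := by
  ext1 i
  simp only [Pi.add_apply, Pi.one_apply]
  generalize e i = a
  fin_cases a <;> rfl

omit [NeZero N] in
theorem eq_add_one_iff (e l : Fin N → Fin 2) : e = l + 1 ↔ l = e + 1 := by
  constructor <;>
  · rintro rfl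
    rw [fin_two_add_one_add_one]

omit [NeZero N] in
theorem bitSign_add_one (l : Fin N → Fin 2) (i : Fin N) : bitSign (l + 1) i = -bitSign l i := by
  simp only [bitSign, Pi.add_apply, Pi.one_apply]
  generalize l i = a
  fin_cases a <;> simp

/-- Labels `l` and `l + 1` (bitwise complement) give the two orthogonal sign combinations of the
same pair of basis vectors. Each has squared norm `2`, hence the factor `1 / 2` in Eve's effects. -/
theorem sum_ghzVec_mul (e e' : Fin N → Fin 2) :
    ∑ l, ghzVec l e * ghzVec l e' = if e = e' then 2 else 0 := by
  have h : ∀ l, ghzVec l e * ghzVec l e'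
      = (if e = l then (if e' = l then 1 else 0) + (if l = e' + 1 then bitSign l 0 else 0) else 0)
        + (if l = e + 1 then (if e' = l then bitSign l 0 else 0) + (if l = e' + 1 then 1 else 0)
          else 0) := by
    intro l
    have := bitSign_mul_self l 0
    simp only [ghzVec, eq_add_one_iff _ l]
    split_ifs <;> first | ring1 | linear_combination this
  simp only [h]
  rw [Finset.sum_add_distrib, Finset.sum_ite_eq, Finset.sum_ite_eq']
  simp only [Finset.mem_univ, if_true, bitSign_add_one, add_left_inj, eq_add_one_iff e' e]
  have h2 : (e' = e) = (e = e') := propext eq_comm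
  simp only [h2]
  split_ifs with h3 h4 <;> norm_num

theorem ghzVec_self_mul_pos (l : Fin N → Fin 2) : 0 < ∑ e, ghzVec l e * ghzVec l e := by
  have h : ghzVec l (l + 1) = 1 := by
    have : l + 1 ≠ l := fun h => by
      have := congrFun h 0
      simp at this
    simp [ghzVec, this]
  exact Finset.sum_pos' (fun e _ => mul_self_nonneg _)
    ⟨l + 1, Finset.mem_univ _, by rw [h]; norm_num⟩

omit [NeZero N] in
theorem tensorOp_qubitX_apply (e e' : Fin N → Fin 2) :
    tensorOp (d := fun _ => 2) (fun _ => qubitObs 1 0) e e' = if e' = e + 1 then 1 else 0 := by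
  rw [tensorOp_apply]
  have h : ∀ a b : Fin 2, qubitObs 1 0 a b = if b = a + 1 then 1 else 0 := by
    intro a b
    fin_cases a <;> fin_cases b <;> simp [qubitObs]
  simp only [h, Fintype.prod_ite_zero, Finset.prod_const_one]
  congr 1
  simp [funext_iff]

/-- The GHZ basis vectors are stabilized by the joint `X` operator up to sign. -/
theorem tensorOp_qubitX_mulVec (l : Fin N → Fin 2) :
    (tensorOp (d := fun _ => 2) fun _ => qubitObs 1 0).mulVec (ghzVec l)
      = bitSign l 0 • ghzVec l := by
  ext e
  simp only [Matrix.mulVec, dotProduct, Pi.smul_apply, smul_eq_mul]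
  rw [Finset.sum_congr rfl fun e' _ => by rw [tensorOp_qubitX_apply e e']]
  simp only [ite_mul, one_mul, zero_mul, Finset.sum_ite_eq', Finset.mem_univ, if_true, ghzVec,
    add_left_inj]
  have h := bitSign_mul_self l 0
  have h1 : (e + 1 = l) = (e = l + 1) := by rw [eq_add_one_iff e l]; exact propext eq_comm
  simp only [h1]
  split_ifs <;> first | ring1 | linear_combination -h

omit [NeZero N] in
theorem localOp_qubitZ_mulVec (i : Fin N) (v : (Fin N → Fin 2) → ℝ) :
    (localOp (d := fun _ => 2) i (qubitObs 0 1)).mulVec v = fun e => bitSign e i * v e := by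
  have h : localOp (d := fun _ => 2) i (qubitObs 0 1)
      = Matrix.diagonal fun e => bitSign e i := by
    ext e e'
    rw [localOp, tensorOp_apply, ← Finset.mul_prod_erase _ _ (Finset.mem_univ i),
      Function.update_self, Finset.prod_congr rfl fun j hj => by
        rw [Function.update_of_ne (Finset.ne_of_mem_erase hj)]]
    by_cases he : e = e'
    · subst he
      simp only [Matrix.one_apply_eq, Finset.prod_const_one, mul_one, Matrix.diagonal_apply_eq,
        bitSign]
      generalize e i = a
      fin_cases a <;> simp [qubitObs]
    · rw [Matrix.diagonal_apply_ne _ he]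
      obtain ⟨j, hj⟩ := Function.ne_iff.mp he
      by_cases hji : j = i
      · subst hji
        have : qubitObs 0 1 (e j) (e' j) = 0 := by
          generalize e j = a, e' j = b at hj
          fin_cases a <;> fin_cases b <;> simp_all [qubitObs]
        rw [this, zero_mul]
      · refine mul_eq_zero_of_right _ (Finset.prod_eq_zero
          (Finset.mem_erase.mpr ⟨hji, Finset.mem_univ j⟩) ?_)
        exact Matrix.one_apply_ne hj
  rw [h]
  ext e
  exact Matrix.mulVec_diagonal _ _ _

/-- The GHZ basis vectors are stabilized by the operators `Z ⊗ Z` up to sign. -/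
theorem localOp_qubitZ_qubitZ_mulVec (l : Fin N → Fin 2) (i : Fin N) :
    (localOp (d := fun _ => 2) 0 (qubitObs 0 1)
      * localOp (d := fun _ => 2) i (qubitObs 0 1)).mulVec (ghzVec l)
      = (bitSign l 0 * bitSign l i) • ghzVec l := by
  rw [← Matrix.mulVec_mulVec, localOp_qubitZ_mulVec, localOp_qubitZ_mulVec]
  ext e
  simp only [Pi.smul_apply, smul_eq_mul, ghzVec]
  split_ifs with h1 h2 h3
  · rw [h1]; ring
  · rw [h1]; ring
  · rw [h3, bitSign_add_one, bitSign_add_one]; ring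
  · ring

/-- Entanglement swapping: maximally entangled pairs transfer Eve's GHZ vector to the external
parties. -/
theorem sum_bellVec_mul_ghzVec (l a a' : Fin N → Fin 2) :
    ∑ e : Fin N → Fin 2, ∑ e' : Fin N → Fin 2,
      (∏ i, (1 / 2 : ℝ) * (bellVec (a i, e i) * bellVec (a' i, e' i)))
        * (1 / 2 * (ghzVec l e' * ghzVec l e))
      = (1 / 2 : ℝ) ^ N * (1 / 2) * (ghzVec l a * ghzVec l a') := by
  have hJ : ∀ e e' : Fin N → Fin 2,
      ∏ i, (1 / 2 : ℝ) * (bellVec (a i, e i) * bellVec (a' i, e' i))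
        = (1 / 2 : ℝ) ^ N * ((if a = e then 1 else 0) * if a' = e' then 1 else 0) := by
    intro e e'
    rw [Finset.prod_mul_distrib, Finset.prod_mul_distrib, Finset.prod_const, Finset.card_univ,
      Fintype.card_fin]
    simp only [bellVec, Fintype.prod_ite_zero, Finset.prod_const_one, funext_iff]
  simp only [hJ]
  rw [Finset.sum_eq_single a (fun e _ he => Finset.sum_eq_zero fun e' _ => by simp [he.symm])
    (by simp), Finset.sum_eq_single a' (fun e' _ he => by simp [he.symm]) (by simp)]
  simp only [if_true]
  ring

end Qubits

/-! ### Expectations in stabilized vectors -/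

section Eigenvectors

theorem smul_mulVec_of_eq {n : Type*} [Fintype n] {K : Matrix n n ℝ} {v : n → ℝ} {b c : ℝ}
    (h : K.mulVec v = c • v) : (b • K).mulVec v = (b * c) • v := by
  rw [Matrix.smul_mulVec, h, smul_smul]

variable {N : ℕ} [NeZero N] (S : RealStarNetwork N)

omit [NeZero N] in
theorem condExpect_of_mulVec_eq {l : Fin N → Fin 2} {v : (∀ i, Fin (S.dA i)) → ℝ} {k c : ℝ}
    {O : S.OpA} (hk : k ≠ 0) (hv : ∑ a, v a * v a ≠ 0)
    (hσ : S.condState l = k • Matrix.vecMulVec v v) (h : O.mulVec v = c • v) :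
    S.condExpect l O = c := by
  have ht : (S.condState l).trace ≠ 0 := by
    rw [hσ, Matrix.trace_smul, Matrix.trace_vecMulVec]
    exact mul_ne_zero hk hv
  have h1 : O * S.condState l = c • S.condState l := by
    rw [hσ, Matrix.mul_smul, Matrix.mul_vecMulVec, h, Matrix.smul_vecMulVec, smul_comm]
  rw [condExpect_eq, h1, Matrix.trace_smul, smul_eq_mul, mul_div_assoc, div_self ht, mul_one]

/-- All signs square away: the `X` term gives `N - 1` and each of the `N - 1` terms `Z ⊗ Z` gives
`1`. -/
theorem bellOp_mulVec_of_stabilizers {l : Fin N → Fin 2} {v : (∀ i, Fin (S.dA i)) → ℝ}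
    (hX : (tensorOp S.opX).mulVec v = bitSign l 0 • v)
    (hZ : ∀ i, (localOp 0 (S.opZ 0) * localOp i (S.opZ i)).mulVec v
      = (bitSign l 0 * bitSign l i) • v) :
    (S.bellOp l).mulVec v = (2 * ((N : ℝ) - 1)) • v := by
  rw [bellOp_eq, localOp_mul_restX]
  have h : ∀ i, (bitSign l i • (localOp 0 (S.opZ 0) * localOp i (S.opZ i))).mulVec v
      = (1 : ℝ) • bitSign l 0 • v := fun i => by
    rw [smul_mulVec_of_eq (hZ i), mul_left_comm, bitSign_mul_self, mul_one, one_smul]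
  rw [smul_mulVec_of_eq (c := 2 * ((N : ℝ) - 1) * bitSign l 0)]
  · rw [mul_left_comm, bitSign_mul_self, mul_one]
  · rw [Matrix.add_mulVec, smul_mulVec_of_eq hX, Matrix.sum_mulVec,
      Finset.sum_congr rfl fun i _ => h i, ← Finset.sum_smul, sum_ne_zero_one]
    module

omit [NeZero N] in
theorem _root_.tensorOp_smul {d : Fin N → ℕ} (c : Fin N → ℝ)
    (M : ∀ i, Matrix (Fin (d i)) (Fin (d i)) ℝ) :
    tensorOp (fun i => c i • M i) = (∏ i, c i) • tensorOp M := by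
  ext a b
  simp only [tensorOp_apply, Matrix.smul_apply, smul_eq_mul, Finset.prod_mul_distrib]

/-- If the third observables are multiples of `X`, every pair operator is a multiple of the
stabilizer `∏ X i`. -/
theorem pairOp_eq_smul {q : Fin N → ℝ} (hq : ∀ i, S.A i 2 = q i • S.opX i) {j k : Fin N}
    (hjk : j ≠ k) : S.pairOp j k = (q j * q k) • tensorOp S.opX := by
  have h : S.pairOp j k = tensorOp fun i => (if i = j ∨ i = k then q i else 1) • S.opX i := by
    unfold pairOp
    congr 1
    ext1 i
    split_ifs
    · exact hq i
    · rw [one_smul]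
  rw [h, tensorOp_smul, ← Finset.mul_prod_erase _ _ (Finset.mem_univ j),
    ← Finset.mul_prod_erase _ _ (Finset.mem_erase.mpr ⟨hjk.symm, Finset.mem_univ k⟩),
    Finset.prod_eq_one fun i hi => ?_]
  · simp
  · simp only [Finset.mem_erase, Finset.mem_univ, and_true] at hi
    simp [hi.1, hi.2]

end Eigenvectors

/-- Every source distributes a maximally entangled pair of qubits, and Eve measures in the GHZ
basis. The third observables are `X` for even and `-X` for odd parties. -/
def ghzNetwork (N : ℕ) [NeZero N] : RealStarNetwork N where
  dA := fun _ => 2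
  dE := fun _ => 2
  ρ := fun _ => (1 / 2 : ℝ) • Matrix.vecMulVec bellVec bellVec
  ρ_posSemidef := fun _ => (Matrix.posSemidef_vecMulVec_self_star bellVec).smul (by norm_num)
  ρ_trace := fun _ => by
    simp [Matrix.trace, Fintype.sum_prod_type, bellVec, Matrix.vecMulVec_apply]
  M := fun i x => qubitEffect (starCoeff i x).1 (starCoeff i x).2
  M_posSemidef := fun i x => qubitEffect_posSemidef (starCoeff_sq i x)
  M_sum := fun _ _ => qubitEffect_sum _ _
  R := fun l => (1 / 2 : ℝ) • Matrix.vecMulVec (ghzVec l) (ghzVec l)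
  R_posSemidef := fun l => (Matrix.posSemidef_vecMulVec_self_star (ghzVec l)).smul (by norm_num)
  R_sum := by
    ext e e'
    simp only [Matrix.sum_apply, Matrix.smul_apply, Matrix.vecMulVec_apply, smul_eq_mul,
      ← Finset.mul_sum, sum_ghzVec_mul, Matrix.one_apply]
    split_ifs <;> norm_num

variable {N : ℕ} [NeZero N]

/-- The GHZ basis vectors as vectors on the joint space of the external parties. -/
def ghzNetworkVec (l : Fin N → Fin 2) : (∀ i, Fin ((ghzNetwork N).dA i)) → ℝ := ghzVec l

theorem ghzNetwork_condState (l : Fin N → Fin 2) :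
    (ghzNetwork N).condState l = ((1 / 2 : ℝ) ^ N * (1 / 2)) •
      Matrix.vecMulVec (ghzNetworkVec l) (ghzNetworkVec l) := by
  ext a a'
  exact sum_bellVec_mul_ghzVec l a a'

theorem ghzNetwork_condExpect {l : Fin N → Fin 2} {O : (ghzNetwork N).OpA} {c : ℝ}
    (h : O.mulVec (ghzNetworkVec l) = c • ghzNetworkVec l) :
    (ghzNetwork N).condExpect l O = c :=
  condExpect_of_mulVec_eq _ (by positivity) (ghzVec_self_mul_pos l).ne' (ghzNetwork_condState l) h

theorem ghzNetwork_A (i : Fin N) (x : Fin 3) :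
    (ghzNetwork N).A i x = qubitObs (starCoeff i x).1 (starCoeff i x).2 :=
  qubitEffect_sub _ _

theorem ghzNetwork_opX (i : Fin N) : (ghzNetwork N).opX i = qubitObs 1 0 := by
  by_cases hi : i = 0
  · subst hi
    rw [opX_zero, tildeA1, ghzNetwork_A, ghzNetwork_A]
    refine (smul_qubitObs_add _ _ _ _ _).trans ?_
    have h := one_div_sqrt_two_mul_self
    congr 1
    · simp only [starCoeff, if_true, Matrix.cons_val_zero, Matrix.cons_val_one]
      linear_combination 2 * h
    · simp [starCoeff]
  · rw [opX_of_ne _ hi, ghzNetwork_A, starCoeff, if_neg hi]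
    rfl

theorem ghzNetwork_opZ (i : Fin N) : (ghzNetwork N).opZ i = qubitObs 0 1 := by
  by_cases hi : i = 0
  · subst hi
    rw [opZ_zero, tildeA0, ghzNetwork_A, ghzNetwork_A]
    refine (smul_qubitObs_sub _ _ _ _ _).trans ?_
    have h := one_div_sqrt_two_mul_self
    congr 1
    · simp [starCoeff]
    · simp only [starCoeff, if_true, Matrix.cons_val_zero, Matrix.cons_val_one]
      linear_combination 2 * h
  · rw [opZ_of_ne _ hi, ghzNetwork_A, starCoeff, if_neg hi]
    rfl

theorem ghzNetwork_A_two (i : Fin N) :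
    (ghzNetwork N).A i 2 = (-1 : ℝ) ^ (i : ℕ) • (ghzNetwork N).opX i := by
  rw [ghzNetwork_A, ghzNetwork_opX]
  have : starCoeff i 2 = ((-1 : ℝ) ^ (i : ℕ), (0 : ℝ)) := by
    unfold starCoeff
    split_ifs with hi
    · subst hi; simp
    · simp
  rw [this]
  refine Eq.trans ?_ (smul_qubitObs _ _ _).symm
  rw [mul_one, mul_zero]

theorem ghzNetwork_tensorOp_opX_mulVec (l : Fin N → Fin 2) :
    (tensorOp (ghzNetwork N).opX).mulVec (ghzNetworkVec l) = bitSign l 0 • ghzNetworkVec l := by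
  have : (ghzNetwork N).opX = fun _ => qubitObs 1 0 := funext ghzNetwork_opX
  rw [this]
  exact tensorOp_qubitX_mulVec l

theorem ghzNetwork_localOp_opZ_mulVec (l : Fin N → Fin 2) (i : Fin N) :
    (localOp 0 ((ghzNetwork N).opZ 0) * localOp i ((ghzNetwork N).opZ i)).mulVec (ghzNetworkVec l)
      = (bitSign l 0 * bitSign l i) • ghzNetworkVec l := by
  rw [ghzNetwork_opZ, ghzNetwork_opZ]
  exact localOp_qubitZ_qubitZ_mulVec l i

theorem ghzNetwork_maximalViolation : (ghzNetwork N).MaximalViolation := fun l =>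
  ghzNetwork_condExpect (bellOp_mulVec_of_stabilizers _ (ghzNetwork_tensorOp_opX_mulVec l)
    (ghzNetwork_localOp_opZ_mulVec l))

theorem ghzNetwork_condExpect_pairOp {j k : Fin N} (hjk : j ≠ k) :
    (ghzNetwork N).condExpect 0 ((ghzNetwork N).pairOp j k)
      = (-1 : ℝ) ^ (j : ℕ) * (-1 : ℝ) ^ (k : ℕ) := by
  refine ghzNetwork_condExpect ?_
  rw [pairOp_eq_smul _ ghzNetwork_A_two hjk, smul_mulVec_of_eq (ghzNetwork_tensorOp_opX_mulVec 0)]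
  simp [bitSign]

/-- Here `q i = (-1) ^ i`, so `∑ q² = N`, while evenness of `N` makes `∑ q = 0`: both estimates of
the upper bound are tight. -/
theorem ghzNetwork_merminValue (hN : 2 ≤ N) (hE : Even N) :
    (ghzNetwork N).merminValue = 1 / ((N : ℝ) - 1) := by
  rw [merminValue_eq _ fun j k hjk => ghzNetwork_condExpect_pairOp hjk]
  have h0 : ∑ i : Fin N, (-1 : ℝ) ^ (i : ℕ) = 0 := by
    rw [Fin.sum_univ_eq_sum_range fun i => (-1 : ℝ) ^ i, neg_one_geom_sum, if_pos hE]
  have h1 : ∑ i : Fin N, ((-1 : ℝ) ^ (i : ℕ)) ^ 2 = N := by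
    simp [← pow_mul, mul_comm _ 2]
  have h2 : (2 : ℝ) ≤ N := by exact_mod_cast hN
  rw [h0, h1, zero_pow two_ne_zero, sub_zero, div_mul_eq_div_div, div_self (by linarith)]

end RealStarNetwork

end

theorem theorem1 (N : ℕ) [NeZero N] (hN : 2 ≤ N) :
    (∀ S : RealStarNetwork N, S.MaximalViolation → S.merminValue ≤ 1 / ((N : ℝ) - 1)) ∧
    (Even N → IsGreatest {J : ℝ | ∃ S : RealStarNetwork N, S.MaximalViolation ∧ S.merminValue = J}
      (1 / ((N : ℝ) - 1))) := by
  refine ⟨fun S hS => hS.merminValue_le hN, fun hE => ⟨⟨RealStarNetwork.ghzNetwork N,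
    RealStarNetwork.ghzNetwork_maximalViolation, RealStarNetwork.ghzNetwork_merminValue hN hE⟩, ?_⟩⟩
  rintro _ ⟨S, hS, rfl⟩
  exact hS.merminValue_le hN
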